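/- Let $(M,g)$ be a smooth Riemannian manifold of dimension $n+1$ with Levi-Civita connection $\overline\nabla$ and curvature tensor $\overline R(X,Y)Z=\overline\nabla_X\overline\nabla_YZ-\overline\nabla_Y\overline\nabla_XZ-\overline\nabla_{[X,Y]}Z$. Let $L$ be an (immersed) smooth hypersurface of $M$, of dimension $n$, with a smooth unit normal vector field $N$, and let $\top$ denote orthogonal projection onto the tangent bundle of $L$. Let $\nabla$ be the induced connection $\nabla_XY=(\overline\nabla_XY)^\top$ on $L$, let $A(X)=-(\overline\nabla_XN)^\top$ be the shape operator, and let $S_r=\sigma_r(\kappa_1,\dots,\kappa_n)$ be the $r$-th elementary symmetric function of the eigenvalues $\kappa_1,\dots,\kappa_n$ of $A$, counted with multiplicity ($S_0=1$, and $S_r=0$ for $r>n$). Let $T_0=I$ and $T_r=S_rI-AT_{r-1}$ be the Newton transformations, and let $\overline R(N)X=\overline R(X,N)N$ for $X$ tangent to $L$. For a smooth function $f$ on $L$ let $\nabla f$ be its gradient for the induced metric, let $\mathrm{Hess} f$ be the endomorphism $X\mapsto\nabla_X\nabla f$ of $TL$, and put $$L_rf=\operatorname{Tr}(T_r\circ\mathrm{Hess}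 f),\qquad J_rf=L_rf+\operatorname{Tr}(A^2T_r)f+\operatorname{Tr}(\overline R(N)T_r)f .$$ Let $U$ be a smooth conformal vector field on $M$ with conformal factor $2k$, that is, $\mathcal L_Ug=2k\,g$ with $k\in C^\infty(M)$, and let $f=\langle U,N\rangle$ on $L$. Then for every integer $r\ge 0$, on $L$, $$J_rf=-U^\top(S_{r+1})-(r+1)\,k\,S_{r+1}-(n-r)\,N(k)\,S_r ;$$ equivalently, $$L_rf=-\langle U,\nabla S_{r+1}\rangle-f\operatorname{Tr}(A^2T_r)-f\operatorname{Tr}(\overline R(N)T_r)-k\operatorname{Tr}(AT_r)-N(k)\operatorname{Tr}(T_r).$$ -/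

import Mathlib

set_option maxSynthPendingDepth 3

open scoped Manifold ContDiff
open Bundle

namespace HypersurfaceGeometry

/-! ### Riemannian metrics in coordinates

Here `E` is a finite-dimensional real vector space and `G y` is the bilinear form by which a
Riemannian metric is represented at the point `y` of a coordinate domain in `E`. -/

section Coordinates

variable {E : Type*} [NormedAddCommGroup E] [NormedSpace ℝ E]

/-- The Christoffel symbols of the first kind, as a trilinear form. -/
noncomputable def christoffelFirst (G : E → E →L[ℝ] E →L[ℝ] ℝ) (y : E) :
    E →L[ℝ] E →L[ℝ] E →L[ℝ] ℝ :=
  (1 / 2 : ℝ) • (fderiv ℝ G y + (fderiv ℝ G y).flip -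
    ((ContinuousLinearMap.flipₗᵢ ℝ E E ℝ).toContinuousLinearEquiv.toContinuousLinearMap).comp
      (fderiv ℝ G y).flip)

/-- `Γ(u, v; c) = ½ (∂_u G(v, c) + ∂_v G(u, c) - ∂_c G(u, v))`. -/
theorem christoffelFirst_apply (G : E → E →L[ℝ] E →L[ℝ] ℝ) (y u v c : E) :
    christoffelFirst G y u v c =
      1 / 2 * (fderiv ℝ G y u v c + fderiv ℝ G y v u c - fderiv ℝ G y c u v) := by
  rfl

/-- The Christoffel symbols of the second kind: `Γ(u, v)` is the vector that the metric
`G y : E → E*` sends to the covector `Γ(u, v; ·)`. The Levi-Civita connection of `G` is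
`∇_u W = ∂_u W + Γ(u, W)`. -/
noncomputable def christoffel (G : E → E →L[ℝ] E →L[ℝ] ℝ) (y : E) : E →L[ℝ] E →L[ℝ] E :=
  (ContinuousLinearMap.compL ℝ E (E →L[ℝ] ℝ) E (G y).inverse).comp (christoffelFirst G y)

theorem christoffel_apply (G : E → E →L[ℝ] E →L[ℝ] ℝ) (y u v : E) :
    christoffel G y u v = (G y).inverse (christoffelFirst G y u v) := by
  rfl

/-- The linear map `u ↦ R(u, v) w`, where
`R(u, v) = ∇_u ∇_v - ∇_v ∇_u - ∇_[u, v]` is the curvature tensor of the metric `G` at `y`. -/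
noncomputable def coordCurvature (G : E → E →L[ℝ] E →L[ℝ] ℝ) (y v w : E) : E →L[ℝ] E :=
  ((fderiv ℝ (christoffel G) y).flip v).flip w - (fderiv ℝ (christoffel G) y v).flip w
    + (christoffel G y).flip (christoffel G y v w)
    - (christoffel G y v).comp ((christoffel G y).flip w)

theorem coordCurvature_apply (G : E → E →L[ℝ] E →L[ℝ] ℝ) (y u v w : E) :
    coordCurvature G y v w u =
      fderiv ℝ (christoffel G) y u v w - fderiv ℝ (christoffel G) y v u w
        + christoffel G y u (christoffel G y v w) - christoffel G y v (christoffel G y u w) := by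
  rfl

/-- The Lie derivative `(ℒ_W G)(a, b) = ∂_W G(a, b) + G(∂_a W, b) + G(a, ∂_b W)` of the metric
`G` along the vector field `W`, at `y`. -/
noncomputable def coordLieDerivMetric (G : E → E →L[ℝ] E →L[ℝ] ℝ) (W : E → E) (y a b : E) : ℝ :=
  fderiv ℝ G y (W y) a b + G y (fderiv ℝ W y a) b + G y a (fderiv ℝ W y b)

end Coordinates

/-! ### Riemannian manifolds -/

section Manifold

variable {E : Type*} [NormedAddCommGroup E] [NormedSpace ℝ E]
  {M : Type*} [TopologicalSpace M] [ChartedSpace E M]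

/-- The differential at `x` of the preferred chart around `c`. -/
noncomputable def chartDiff (c x : M) : TangentSpace 𝓘(ℝ, E) x →L[ℝ] E :=
  mfderiv 𝓘(ℝ, E) 𝓘(ℝ, E) (extChartAt 𝓘(ℝ, E) c) x

/-- The differential at `y` of the inverse of the preferred chart around `c`. -/
noncomputable def chartSymmDiff (c : M) (y : E) :
    E →L[ℝ] TangentSpace 𝓘(ℝ, E) ((extChartAt 𝓘(ℝ, E) c).symm y) :=
  mfderiv 𝓘(ℝ, E) 𝓘(ℝ, E) (extChartAt 𝓘(ℝ, E) c).symm y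

/-- A vector field, read in the preferred chart around `c`. -/
noncomputable def chartField (W : ∀ x : M, TangentSpace 𝓘(ℝ, E) x) (c : M) (y : E) : E :=
  chartDiff c ((extChartAt 𝓘(ℝ, E) c).symm y) (W ((extChartAt 𝓘(ℝ, E) c).symm y))

/-- The identification of the coordinate space with `T_x M` through the preferred chart
around `x`. -/
noncomputable def fromCoord (x : M) : E →L[ℝ] TangentSpace 𝓘(ℝ, E) x :=
  (chartDiff x x).inverse

variable [IsManifold 𝓘(ℝ, E) ∞ M]

/-- The coordinate expression of the metric in the preferred chart around `c`. -/
noncomputable def chartMetric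
    (g : ContMDiffRiemannianMetric 𝓘(ℝ, E) ∞ E (fun x : M => TangentSpace 𝓘(ℝ, E) x))
    (c : M) (y : E) : E →L[ℝ] E →L[ℝ] ℝ :=
  ((chartSymmDiff c y).precomp ℝ).comp
    ((g.inner ((extChartAt 𝓘(ℝ, E) c).symm y)).comp (chartSymmDiff c y))

/-- For `v, w ∈ T_x M`, the linear map `u ↦ R(u, v) w` on `T_x M`, where `R` is the curvature
tensor of the Levi-Civita connection. -/
noncomputable def curvature
    (g : ContMDiffRiemannianMetric 𝓘(ℝ, E) ∞ E (fun x : M => TangentSpace 𝓘(ℝ, E) x))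
    (x : M) (v w : TangentSpace 𝓘(ℝ, E) x) :
    TangentSpace 𝓘(ℝ, E) x →L[ℝ] TangentSpace 𝓘(ℝ, E) x :=
  (fromCoord x).comp
    ((coordCurvature (chartMetric g x) (extChartAt 𝓘(ℝ, E) x x)
      (chartDiff x x v) (chartDiff x x w)).comp (chartDiff x x))

/-- `U` is a conformal vector field with conformal factor `2k`: `ℒ_U g = 2 k g`. -/
structure IsConformalField
    (g : ContMDiffRiemannianMetric 𝓘(ℝ, E) ∞ E (fun x : M => TangentSpace 𝓘(ℝ, E) x))
    (U : ∀ x : M, TangentSpace 𝓘(ℝ, E) x) (k : M → ℝ) : Prop where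
  contMDiff_field : ContMDiff 𝓘(ℝ, E) 𝓘(ℝ, E).tangent ∞
    (fun x => (⟨x, U x⟩ : TangentBundle 𝓘(ℝ, E) M))
  contMDiff_factor : ContMDiff 𝓘(ℝ, E) 𝓘(ℝ, ℝ) ∞ k
  lieDeriv_metric : ∀ (x : M) (a b : TangentSpace 𝓘(ℝ, E) x),
    coordLieDerivMetric (chartMetric g x) (chartField U x) (extChartAt 𝓘(ℝ, E) x x)
      (chartDiff x x a) (chartDiff x x b) = 2 * k x * g.inner x a b

/-- The derivative `v(f)` of a real function in the direction of the tangent vector `v`. -/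
noncomputable def directionalDeriv (f : M → ℝ) (x : M) (v : TangentSpace 𝓘(ℝ, E) x) : ℝ :=
  mfderiv 𝓘(ℝ, E) 𝓘(ℝ, ℝ) f x v

end Manifold

/-! ### Immersed hypersurfaces -/

section Hypersurface

variable {E : Type*} [NormedAddCommGroup E] [NormedSpace ℝ E]
  (F : Type*) [NormedAddCommGroup F] [NormedSpace ℝ F]
  {M : Type*} [TopologicalSpace M] [ChartedSpace E M] [IsManifold 𝓘(ℝ, E) ∞ M]
  {L : Type*} [TopologicalSpace L] [ChartedSpace F L]
  (g : ContMDiffRiemannianMetric 𝓘(ℝ, E) ∞ E (fun x : M => TangentSpace 𝓘(ℝ, E) x))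
  (ι : L → M)

/-- The covariant derivative `v ↦ ∇̄_v W` at `p`, for the Levi-Civita connection `∇̄` of `M`, of
a vector field `W` of `M` along the map `ι : L → M`. In the coordinates of `M` around `ι p` it
is `∂_v W + Γ(dι v, W)`. -/
noncomputable def covDerivAlong (W : ∀ q : L, TangentSpace 𝓘(ℝ, E) (ι q)) (p : L) :
    TangentSpace 𝓘(ℝ, F) p →L[ℝ] TangentSpace 𝓘(ℝ, E) (ι p) :=
  let dW : TangentSpace 𝓘(ℝ, F) p →L[ℝ] E :=
    mfderiv 𝓘(ℝ, F) 𝓘(ℝ, E) (fun q : L => chartDiff (ι p) (ι q) (W q)) p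
  let Γ : E →L[ℝ] E →L[ℝ] E :=
    christoffel (chartMetric g (ι p)) (extChartAt 𝓘(ℝ, E) (ι p) (ι p))
  (fromCoord (ι p)).comp
    (dW + (Γ.flip (chartDiff (ι p) (ι p) (W p))).comp
      ((chartDiff (ι p) (ι p)).comp (mfderiv 𝓘(ℝ, F) 𝓘(ℝ, E) ι p)))

/-- `N` is a smooth field of unit normal vectors along `ι`. -/
structure IsUnitNormalField (N : ∀ p : L, TangentSpace 𝓘(ℝ, E) (ι p)) : Prop where
  contMDiff : ContMDiff 𝓘(ℝ, F) 𝓘(ℝ, E).tangent ∞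
    (fun p => (⟨ι p, N p⟩ : TangentBundle 𝓘(ℝ, E) M))
  normal : ∀ (p : L) (v : TangentSpace 𝓘(ℝ, F) p),
    g.inner (ι p) (N p) (mfderiv 𝓘(ℝ, F) 𝓘(ℝ, E) ι p v) = 0
  unit : ∀ p : L, g.inner (ι p) (N p) (N p) = 1

/-- The metric induced on `L` by `ι`. -/
noncomputable def inducedMetric (p : L) :
    TangentSpace 𝓘(ℝ, F) p →L[ℝ] TangentSpace 𝓘(ℝ, F) p →L[ℝ] ℝ :=
  ((mfderiv 𝓘(ℝ, F) 𝓘(ℝ, E) ι p).precomp ℝ).comp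
    ((g.inner (ι p)).comp (mfderiv 𝓘(ℝ, F) 𝓘(ℝ, E) ι p))

/-- The tangential part `w^⊤ ∈ T_p L` of `w ∈ T_{ι p} M`: the vector with
`⟨w^⊤, v⟩ = ⟨w, dι v⟩` for all `v ∈ T_p L`. -/
noncomputable def tangentialPart (p : L) :
    TangentSpace 𝓘(ℝ, E) (ι p) →L[ℝ] TangentSpace 𝓘(ℝ, F) p :=
  (inducedMetric F g ι p).inverse.comp
    (((mfderiv 𝓘(ℝ, F) 𝓘(ℝ, E) ι p).precomp ℝ).comp (g.inner (ι p)))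

/-- The gradient on `L` of a function, for the induced metric. -/
noncomputable def surfaceGradient (f : L → ℝ) (p : L) : TangentSpace 𝓘(ℝ, F) p :=
  (inducedMetric F g ι p).inverse (mfderiv 𝓘(ℝ, F) 𝓘(ℝ, ℝ) f p)

/-- The induced connection `∇_v Y = (∇̄_v Y)^⊤` on vector fields of `L`, as the linear map
`v ↦ ∇_v Y`. -/
noncomputable def inducedConnection (Y : ∀ q : L, TangentSpace 𝓘(ℝ, F) q) (p : L) :
    TangentSpace 𝓘(ℝ, F) p →L[ℝ] TangentSpace 𝓘(ℝ, F) p :=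
  (tangentialPart F g ι p).comp
    (covDerivAlong F g ι (fun q => mfderiv 𝓘(ℝ, F) 𝓘(ℝ, E) ι q (Y q)) p)

/-- The Hessian `v ↦ ∇_v ∇f` of a function on `L`. -/
noncomputable def hessian (f : L → ℝ) (p : L) :
    TangentSpace 𝓘(ℝ, F) p →L[ℝ] TangentSpace 𝓘(ℝ, F) p :=
  inducedConnection F g ι (surfaceGradient F g ι f) p

variable (N : ∀ p : L, TangentSpace 𝓘(ℝ, E) (ι p))

/-- The shape operator `A v = -(∇̄_v N)^⊤`. -/
noncomputable def shapeOperator (p : L) :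
    TangentSpace 𝓘(ℝ, F) p →L[ℝ] TangentSpace 𝓘(ℝ, F) p :=
  -(tangentialPart F g ι p).comp (covDerivAlong F g ι N p)

/-- The operator `v ↦ (R̄(v, N) N)^⊤` on `T_p L`. -/
noncomputable def normalCurvature (p : L) :
    TangentSpace 𝓘(ℝ, F) p →L[ℝ] TangentSpace 𝓘(ℝ, F) p :=
  (tangentialPart F g ι p).comp
    ((curvature g (ι p) (N p) (N p)).comp (mfderiv 𝓘(ℝ, F) 𝓘(ℝ, E) ι p))

/-- The trace of an endomorphism of a tangent space. -/
noncomputable def tangentTrace {F : Type*} [NormedAddCommGroup F] [NormedSpace ℝ F] [ChartedSpace F L] {p : L}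
    (B : TangentSpace 𝓘(ℝ, F) p →L[ℝ] TangentSpace 𝓘(ℝ, F) p) : ℝ :=
  LinearMap.trace ℝ (TangentSpace 𝓘(ℝ, F) p) B.toLinearMap

variable [FiniteDimensional ℝ F]

/-- Tangent spaces of `L` are finite-dimensional. -/
instance instFiniteTangentSpace (p : L) : Module.Finite ℝ (TangentSpace 𝓘(ℝ, F) p) :=
  inferInstanceAs (Module.Finite ℝ F)

/-- The principal curvatures at `p`: the eigenvalues of the shape operator, with
multiplicities. -/
noncomputable def principalCurvatures (p : L) : Multiset ℝ :=
  (shapeOperator F g ι N p).toLinearMap.charpoly.roots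

/-- The mean curvature `S_r`, the `r`-th elementary symmetric function of the principal
curvatures (in particular `S_0 = 1`, and `S_r = 0` for `r > dim L`). -/
noncomputable def meanCurvature (r : ℕ) (p : L) : ℝ :=
  (principalCurvatures F g ι N p).esymm r

/-- The Newton transformations: `T_0 = I` and `T_r = S_r I - A T_{r-1}`. -/
noncomputable def newton : ℕ → ∀ p : L,
    TangentSpace 𝓘(ℝ, F) p →L[ℝ] TangentSpace 𝓘(ℝ, F) p
  | 0, p => ContinuousLinearMap.id ℝ (TangentSpace 𝓘(ℝ, F) p)
  | r + 1, p =>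
      meanCurvature F g ι N (r + 1) p • ContinuousLinearMap.id ℝ (TangentSpace 𝓘(ℝ, F) p) -
        (shapeOperator F g ι N p).comp (newton r p)

/-- `L_r f = Tr(T_r ∘ Hess f)`. -/
noncomputable def operatorL (r : ℕ) (f : L → ℝ) (p : L) : ℝ :=
  tangentTrace ((newton F g ι N r p).comp (hessian F g ι f p))

/-- `J_r f = L_r f + Tr(A² T_r) f + Tr(R̄(N) T_r) f`. -/
noncomputable def operatorJ (r : ℕ) (f : L → ℝ) (p : L) : ℝ :=
  operatorL F g ι N r f p
    + tangentTrace ((shapeOperator F g ι N p).comp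
        ((shapeOperator F g ι N p).comp (newton F g ι N r p))) * f p
    + tangentTrace ((normalCurvature F g ι N p).comp (newton F g ι N r p)) * f p

end Hypersurface

end HypersurfaceGeometry

open HypersurfaceGeometry

/-!
The formula is proved in coordinates and then transferred to the manifolds.

**In coordinates.** Let `φ` be the immersion, `ν` the normal field, `u` the conformal field, `κ`
its factor, `D` covariant differentiation along `φ`, `A` the shape operator, `z = u^⊤`, and let
`f = ⟨u, ν⟩`. Three properties of `D` carry the argument: compatibility with the metric
(`IsMetricOn.fderiv_metric`), absence of torsion (`IsMetricOn.covAlong_fderiv_symm`), and the fact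
that the commutator `D_v D_w - D_w D_v` is the curvature (`IsMetricOn.covAlong_comm`). They give
the symmetries of the curvature tensor, the Weingarten, Gauss and Codazzi formulas, and, since
`∇u` is `κ I` plus a skew-adjoint part, the identity (`IsConformalOn.covField₂_eq`)
`⟨∇²_{c,a} u, b⟩ = dκ(c) ⟨a, b⟩ + dκ(a) ⟨b, c⟩ - dκ(b) ⟨c, a⟩ - ⟨R(b, a) c, u⟩`.

Differentiating `f` twice, the Codazzi term and the part of this identity that involves `z` cancel
by the pair symmetry of the curvature, and what is left is (`coordHess_supportFunction`)
`Hess f = -∇_z A - f A² - ν(κ) I - f R(·, ν) ν - κ A + [β, A]`,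
where `β` is the tangential part of `∇u`. Now multiply by `T_r` and take traces. As `T_r` is a
polynomial in `A`, the commutator `[β, A]` contributes nothing, and neither does the difference
between `∇_z A` and the plain derivative `∂_z A`, which is a commutator with `A` too. Finally
`Tr(T_r ∂_z A) = ∂_z S_{r+1}`: this is Jacobi's formula for `det (1 - s A)`, because the
coefficients of `adj (1 - s A)` are, up to sign, the Newton transformations
(`coeff_adjugate_one_sub`, `hasFDerivAt_endSymm`). The same expansion yields
`Tr(A T_r) = (r + 1) S_{r+1}` and `Tr T_r = (n - r) S_r`, by which the two forms of the result are equivalent.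

**Transfer.** The definitions use at each point `q` the preferred chart around `q`, whereas the
differentiation of `S_{r+1}` requires one chart for all points near `p`. The transformation law of
the Christoffel symbols shows that covariant derivatives along a map and the Lie derivative of the
metric do not depend on the chart (`IsCoordChangeAt.covAlong`,
`IsCoordChangeAt.coordLieDerivMetric`). Hence the shape operators near `p` are conjugate to those
computed in the charts around `p` and `ι p`, and the equation `ℒ_U g = 2 k g` holds throughout the
chart around `ι p`. The shape operator is self-adjoint for the induced metric, so its
characteristic polynomial splits, and the elementary symmetric functions of its roots are the
coefficients of that polynomial (`meanCurvature_eq`).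
-/

set_option linter.unusedSectionVars false

namespace HypersurfaceGeometry

/-! ### Elementary symmetric functions and Newton transformations of an endomorphism -/

section Algebra

open Polynomial Matrix

variable {m : Type*} [Fintype m] [DecidableEq m]

/-- Jacobi's formula: the derivative of `det A` is `tr (adj A ∘ A')`. -/
theorem hasFDerivAt_det {V : Type*} [NormedAddCommGroup V] [NormedSpace ℝ V]
    {A : V → Matrix m m ℝ} {A' : m → m → V →L[ℝ] ℝ} {x : V}
    (hA : ∀ i j, HasFDerivAt (fun y => A y i j) (A' i j) x) :
    HasFDerivAt (fun y => (A y).det) (∑ i, ∑ j, (A x).adjugate i j • A' j i) x := by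
  simp only [det_apply]
  have h1 : HasFDerivAt (fun y => ∑ σ : Equiv.Perm m, Equiv.Perm.sign σ • ∏ i, A y (σ i) i)
      (∑ σ : Equiv.Perm m, Equiv.Perm.sign σ •
        ∑ i, (∏ j ∈ Finset.univ.erase i, A x (σ j) j) • A' (σ i) i) x := by
    refine HasFDerivAt.fun_sum fun σ _ => ?_
    simp only [Units.smul_def, ← Int.cast_smul_eq_zsmul ℝ]
    have h0 := HasFDerivAt.finsetProd (u := Finset.univ) (g := fun i y => A y (σ i) i)
      (g' := fun i => A' (σ i) i) (x := x) fun i _ => hA (σ i) i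
    exact h0.const_smul (((Equiv.Perm.sign σ : ℤ)) : ℝ)
  refine h1.congr_fderiv ?_
  ext v
  simp only [_root_.sum_apply, _root_.smul_apply, Finset.smul_sum,
    smul_eq_mul]
  rw [Finset.sum_comm]
  refine Finset.sum_congr rfl fun i _ => ?_
  have h2 : ∑ j, (A x).adjugate i j * A' j i v =
      ((A x).updateCol i (fun j => A' j i v)).det := by
    rw [← cramer_apply, cramer_eq_adjugate_mulVec]
    rfl
  rw [h2, det_apply]
  refine Finset.sum_congr rfl fun σ _ => ?_
  rw [← Finset.mul_prod_erase _ _ (Finset.mem_univ i), mul_comm]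
  congr 2
  · simp
  · refine Finset.prod_congr rfl fun j hj => ?_
    rw [updateCol_ne (Finset.ne_of_mem_erase hj)]

/-- The `r`-th elementary symmetric function of the eigenvalues of `A`, read off without reference
to eigenvalues as `(-1) ^ r` times the coefficient of `X ^ r` in `det (1 - X A)`. -/
noncomputable def matrixSymm (A : Matrix m m ℝ) (r : ℕ) : ℝ :=
  (-1) ^ r * A.charpolyRev.coeff r

/-- The Newton transformations `T_0 = 1`, `T_{r+1} = σ_{r+1}(A) - A T_r` of a matrix. -/
noncomputable def matrixNewton (A : Matrix m m ℝ) : ℕ → Matrix m m ℝ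
  | 0 => 1
  | r + 1 => matrixSymm A (r + 1) • 1 - A * matrixNewton A r

/-- The coefficients of `adj (1 - X A)` are, up to sign, the Newton transformations of `A`: compare
coefficients in `(1 - X A) adj (1 - X A) = det (1 - X A)`. -/
theorem coeff_adjugate_one_sub (A : Matrix m m ℝ) (r : ℕ) (i j : m) :
    (adjugate (1 - (X : ℝ[X]) • A.map C) i j).coeff r = (-1) ^ r * matrixNewton A r i j := by
  have key : ∀ i j, adjugate (1 - (X : ℝ[X]) • A.map C) i j =
      X * ∑ k, C (A i k) * adjugate (1 - (X : ℝ[X]) • A.map C) k j +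
        A.charpolyRev * C ((1 : Matrix m m ℝ) i j) := by
    intro i j
    have h := congrFun (congrFun (mul_adjugate (1 - (X : ℝ[X]) • A.map C)) i) j
    rw [sub_mul, one_mul, Matrix.sub_apply, smul_mul, Matrix.smul_apply, mul_apply] at h
    simp only [map_apply, Matrix.smul_apply, smul_eq_mul] at h
    rw [sub_eq_iff_eq_add'] at h
    rw [h, charpolyRev]
    congr 2
    simp [one_apply, apply_ite C]
  induction r generalizing i j with
  | zero =>
    rw [key]
    have : A.charpolyRev.coeff 0 = 1 := by rw [coeff_zero_eq_eval_zero, eval_charpolyRev]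
    simp [matrixNewton, this]
  | succ r ih =>
    rw [key, coeff_add, coeff_X_mul, finsetSum_coeff]
    simp only [coeff_C_mul, coeff_mul_C, ih, matrixNewton, Matrix.sub_apply, Matrix.smul_apply,
      mul_apply, smul_eq_mul, matrixSymm]
    have e : ((-1 : ℝ) ^ (r + 1)) * (-1) ^ (r + 1) = 1 := by
      rw [← mul_pow]; simp
    rw [mul_sub, ← mul_assoc, ← mul_assoc, e, one_mul, Finset.mul_sum, add_comm, sub_eq_add_neg,
      ← Finset.sum_neg_distrib]
    congr 1
    refine Finset.sum_congr rfl fun k _ => ?_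
    ring

/-- A coefficient of a polynomial of bounded degree is a fixed linear combination of its values
(Lagrange interpolation), so coefficients may be differentiated by differentiating values. -/
theorem coeff_eq_sum_eval (d r : ℕ) : ∃ w : Fin (d + 1) → ℝ, ∀ P : ℝ[X], P.natDegree ≤ d →
    P.coeff r = ∑ i, w i * P.eval (i : ℝ) := by
  have hinj : Set.InjOn (fun i : Fin (d + 1) => (i : ℝ)) (Finset.univ : Finset (Fin (d + 1))) := by
    intro i _ j _ hij
    exact Fin.ext (Nat.cast_injective (R := ℝ) hij)
  refine ⟨fun i => (Lagrange.basis Finset.univ (fun i : Fin (d + 1) => (i : ℝ)) i).coeff r,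
    fun P hP => ?_⟩
  have h := Lagrange.eq_interpolate (f := P) hinj (by
    rw [Finset.card_univ, Fintype.card_fin]
    refine lt_of_le_of_lt degree_le_natDegree ?_
    exact_mod_cast Nat.lt_succ_of_le hP)
  conv_lhs => rw [h]
  rw [Lagrange.interpolate_apply, finsetSum_coeff]
  refine Finset.sum_congr rfl fun i _ => ?_
  rw [coeff_C_mul, mul_comm]

theorem natDegree_charpolyRev_le (A : Matrix m m ℝ) : A.charpolyRev.natDegree ≤ Fintype.card m := by
  rw [← reverse_charpoly]
  exact (reverse_natDegree_le _).trans (charpoly_natDegree_eq_dim A).le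

theorem eval_det_one_sub (A : Matrix m m ℝ) (s : ℝ) :
    A.charpolyRev.eval s = (1 - s • A).det := by
  rw [charpolyRev, ← coe_evalRingHom, RingHom.map_det]
  congr 1
  ext i j
  by_cases h : i = j <;> simp [h, mul_comm s]

theorem eval_adjugate_one_sub (A : Matrix m m ℝ) (s : ℝ) (i j : m) :
    (adjugate (1 - (X : ℝ[X]) • A.map C) i j).eval s = (1 - s • A).adjugate i j := by
  have : (1 - s • A) = (evalRingHom s).mapMatrix (1 - (X : ℝ[X]) • A.map C) := by
    ext i j
    by_cases h : i = j <;> simp [h, mul_comm s]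
  rw [this, ← RingHom.map_adjugate]
  rfl

/-- The derivative of `σ_{r+1}(A)` is `tr (T_r A')`. -/
theorem hasFDerivAt_matrixSymm {V : Type*} [NormedAddCommGroup V] [NormedSpace ℝ V]
    {A : V → Matrix m m ℝ} {A' : m → m → V →L[ℝ] ℝ} {x : V}
    (hA : ∀ i j, HasFDerivAt (fun y => A y i j) (A' i j) x) (r : ℕ) :
    HasFDerivAt (fun y => matrixSymm (A y) (r + 1))
      (∑ i, ∑ j, matrixNewton (A x) r i j • A' j i) x := by
  set Q : V → ℝ[X] := fun v => - (X * ∑ i, ∑ j,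
    adjugate (1 - (X : ℝ[X]) • (A x).map C) i j * C (A' j i v)) with hQ
  obtain ⟨d, hd, hQd⟩ : ∃ d, Fintype.card m ≤ d ∧ ∀ v, (Q v).natDegree ≤ d := by
    refine ⟨Fintype.card m + (1 + ∑ i, ∑ j,
      (adjugate (1 - (X : ℝ[X]) • (A x).map C) i j).natDegree), by omega, fun v => ?_⟩
    rw [hQ, natDegree_neg]
    refine natDegree_mul_le.trans ?_
    rw [natDegree_X]
    refine le_trans ?_ (Nat.le_add_left _ _)
    refine Nat.add_le_add_left ?_ 1
    refine natDegree_sum_le_of_forall_le _ _ fun i _ => ?_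
    refine natDegree_sum_le_of_forall_le _ _ fun j _ => ?_
    refine (natDegree_mul_C_le _ _).trans ?_
    refine le_trans ?_ (Finset.single_le_sum (f := fun i => ∑ j,
      (adjugate (1 - (X : ℝ[X]) • (A x).map C) i j).natDegree) (fun _ _ => Nat.zero_le _)
      (Finset.mem_univ i))
    exact Finset.single_le_sum (f := fun j =>
      (adjugate (1 - (X : ℝ[X]) • (A x).map C) i j).natDegree) (fun _ _ => Nat.zero_le _)
      (Finset.mem_univ j)
  obtain ⟨w, hw⟩ := coeff_eq_sum_eval d (r + 1)
  have h1 : (fun y => matrixSymm (A y) (r + 1)) =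
      fun y => (-1) ^ (r + 1) * ∑ k, w k * (1 - (k : ℝ) • A y).det := by
    funext y
    rw [matrixSymm, hw _ ((natDegree_charpolyRev_le _).trans hd)]
    simp only [eval_det_one_sub]
  rw [h1]
  have h2 : ∀ k : Fin (d + 1), HasFDerivAt (fun y => (1 - (k : ℝ) • A y).det)
      (∑ i, ∑ j, (1 - (k : ℝ) • A x).adjugate i j • (-((k : ℝ) • A' j i))) x := by
    intro k
    refine hasFDerivAt_det (A := fun y => 1 - (k : ℝ) • A y) (A' := fun i j => -((k : ℝ) • A' i j))
      fun i j => ?_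
    simp only [Matrix.sub_apply, Matrix.smul_apply]
    exact ((hA i j).const_smul (k : ℝ)).const_sub _
  refine (((HasFDerivAt.fun_sum fun k (_ : k ∈ Finset.univ) => (h2 k).const_mul (w k))).const_mul
    _).congr_fderiv ?_
  ext v
  have h3 : ∀ k : Fin (d + 1), (∑ i, ∑ j, (1 - (k : ℝ) • A x).adjugate i j •
      (-((k : ℝ) • A' j i))) v = (Q v).eval (k : ℝ) := by
    intro k
    simp only [hQ, eval_neg, eval_mul, eval_X, eval_finsetSum, eval_C, eval_adjugate_one_sub,
      _root_.sum_apply, _root_.smul_apply, smul_eq_mul,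
      _root_.neg_apply, mul_neg, Finset.sum_neg_distrib, Finset.mul_sum]
    congr 1
    refine Finset.sum_congr rfl fun i _ => Finset.sum_congr rfl fun j _ => by ring
  rw [_root_.smul_apply, _root_.sum_apply]
  simp only [_root_.smul_apply, smul_eq_mul] at h3 ⊢
  simp only [h3]
  rw [← hw _ (hQd v), hQ]
  simp only [coeff_neg, coeff_X_mul, finsetSum_coeff, coeff_mul_C, coeff_adjugate_one_sub,
    _root_.sum_apply, _root_.smul_apply, smul_eq_mul]
  rw [mul_neg, Finset.mul_sum, ← Finset.sum_neg_distrib]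
  refine Finset.sum_congr rfl fun i _ => ?_
  rw [Finset.mul_sum, ← Finset.sum_neg_distrib]
  refine Finset.sum_congr rfl fun j _ => ?_
  have e : ((-1 : ℝ) ^ r) * (-1) ^ r = 1 := by
    rw [← mul_pow]; simp
  rw [pow_succ]
  linear_combination (matrixNewton (A x) r i j * A' j i v) * e

theorem trace_mul_matrixNewton (A : Matrix m m ℝ) (r : ℕ) :
    (A * matrixNewton A r).trace = (r + 1) * matrixSymm A (r + 1) := by
  have h := hasFDerivAt_matrixSymm (A := fun t : ℝ => t • A)
    (A' := fun i j => ContinuousLinearMap.toSpanSingleton ℝ (A i j)) (x := 1) (fun i j => by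
      have := (hasDerivAt_mul_const (x := (1 : ℝ)) (A i j)).hasFDerivAt
      convert! this using 1) r
  have h2 : (fun t : ℝ => matrixSymm (t • A) (r + 1)) =
      fun t => t ^ (r + 1) * matrixSymm A (r + 1) := by
    funext t
    have : (t • A).charpolyRev = A.charpolyRev.comp (C t * X) := by
      refine Polynomial.funext fun s => ?_
      rw [eval_det_one_sub, eval_comp, eval_det_one_sub, eval_mul, eval_C, eval_X, smul_smul,
        mul_comm]
    rw [matrixSymm, matrixSymm, this, comp_C_mul_X_coeff]
    ring
  rw [h2] at h
  have h3 : HasFDerivAt (fun t : ℝ => t ^ (r + 1) * matrixSymm A (r + 1)) _ 1 :=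
    ((hasDerivAt_pow (r + 1) (1 : ℝ)).mul_const (matrixSymm A (r + 1))).hasFDerivAt
  have h4 := congrArg (fun l => l 1) (h.unique h3)
  simp only [one_smul, _root_.sum_apply, _root_.smul_apply,
    ContinuousLinearMap.toSpanSingleton_apply, smul_eq_mul, one_mul] at h4
  rw [trace_mul_comm]
  simp only [trace, diag_apply, mul_apply]
  rw [h4]
  simp

theorem trace_matrixNewton (A : Matrix m m ℝ) (r : ℕ) :
    (matrixNewton A r).trace = (Fintype.card m - r) * matrixSymm A r := by
  cases r with
  | zero =>
    have : A.charpolyRev.coeff 0 = 1 := by rw [coeff_zero_eq_eval_zero, eval_charpolyRev]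
    simp [matrixNewton, matrixSymm, this]
  | succ r =>
    rw [matrixNewton, trace_sub, trace_smul, trace_one, trace_mul_matrixNewton]
    push_cast
    simp only [smul_eq_mul]
    ring

section LinearMap

variable {V : Type*} [AddCommGroup V] [Module ℝ V] [FiniteDimensional ℝ V]

/-- The `r`-th elementary symmetric function of the eigenvalues of an endomorphism, expressed by
the coefficients of its characteristic polynomial. -/
noncomputable def endSymm (f : V →ₗ[ℝ] V) (r : ℕ) : ℝ :=
  (-1) ^ r * f.charpoly.reverse.coeff r

/-- The Newton transformations `T_0 = I`, `T_r = σ_r(f) I - f T_{r-1}` of an endomorphism. -/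
noncomputable def endNewton (f : V →ₗ[ℝ] V) : ℕ → V →ₗ[ℝ] V
  | 0 => LinearMap.id
  | r + 1 => endSymm f (r + 1) • LinearMap.id - f ∘ₗ endNewton f r

theorem endSymm_eq_matrixSymm (b : Module.Basis m ℝ V) (f : V →ₗ[ℝ] V) (r : ℕ) :
    endSymm f r = matrixSymm (LinearMap.toMatrix b b f) r := by
  rw [endSymm, matrixSymm, ← reverse_charpoly, LinearMap.charpoly_toMatrix]

theorem toMatrix_endNewton (b : Module.Basis m ℝ V) (f : V →ₗ[ℝ] V) (r : ℕ) :
    LinearMap.toMatrix b b (endNewton f r) = matrixNewton (LinearMap.toMatrix b b f) r := by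
  induction r with
  | zero => simp [endNewton, matrixNewton]
  | succ r ih =>
    rw [endNewton, matrixNewton, map_sub, map_smul, LinearMap.toMatrix_comp b b b, ih,
      LinearMap.toMatrix_id, endSymm_eq_matrixSymm b]

theorem trace_comp_endNewton (f : V →ₗ[ℝ] V) (r : ℕ) :
    LinearMap.trace ℝ V (f ∘ₗ endNewton f r) = (r + 1) * endSymm f (r + 1) := by
  classical
  let b := Module.finBasis ℝ V
  rw [LinearMap.trace_eq_matrix_trace ℝ b, LinearMap.toMatrix_comp b b b, toMatrix_endNewton,
    trace_mul_matrixNewton, endSymm_eq_matrixSymm b]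

theorem trace_endNewton (f : V →ₗ[ℝ] V) (r : ℕ) :
    LinearMap.trace ℝ V (endNewton f r) = (Module.finrank ℝ V - r) * endSymm f r := by
  classical
  let b := Module.finBasis ℝ V
  rw [LinearMap.trace_eq_matrix_trace ℝ b, toMatrix_endNewton, trace_matrixNewton,
    endSymm_eq_matrixSymm b, Fintype.card_fin]

theorem endNewton_comm (f : V →ₗ[ℝ] V) (r : ℕ) : f ∘ₗ endNewton f r = endNewton f r ∘ₗ f := by
  induction r with
  | zero => simp [endNewton]
  | succ r ih =>
    rw [endNewton, LinearMap.comp_sub, LinearMap.sub_comp, LinearMap.comp_smul,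
      LinearMap.smul_comp, LinearMap.comp_id, LinearMap.id_comp, LinearMap.comp_assoc, ← ih]

theorem esymm_roots_charpoly {f : V →ₗ[ℝ] V} (hf : f.charpoly.Splits) (r : ℕ) :
    f.charpoly.roots.esymm r = endSymm f r := by
  have hcard : f.charpoly.roots.card = f.charpoly.natDegree := (splits_iff_card_roots.mp hf)
  rcases le_or_gt r f.charpoly.natDegree with h | h
  · rw [endSymm, coeff_reverse, revAt_le h,
      coeff_eq_esymm_roots_of_card hcard (Nat.sub_le _ _), f.charpoly_monic.leadingCoeff,
      Nat.sub_sub_self h, one_mul, ← mul_assoc, ← mul_pow]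
    simp
  · rw [endSymm, coeff_eq_zero_of_natDegree_lt (lt_of_le_of_lt (reverse_natDegree_le _) h),
      Multiset.esymm, Multiset.powersetCard_eq_empty _ (by rw [hcard]; exact h)]
    simp

/-- The characteristic polynomial of an endomorphism that is symmetric with respect to some inner
product splits over the reals. -/
theorem splits_charpoly_of_symm (h : V →ₗ[ℝ] V →ₗ[ℝ] ℝ) (hs : ∀ v w, h v w = h w v)
    (hp : ∀ v, v ≠ 0 → 0 < h v v) {f : V →ₗ[ℝ] V} (hf : ∀ v w, h (f v) w = h v (f w)) :
    f.charpoly.Splits := by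
  let c : InnerProductSpace.Core ℝ V :=
    { inner := fun v w => h v w
      conj_inner_symm := fun v w => by simpa using hs w v
      re_inner_nonneg := fun v => by
        rcases eq_or_ne v 0 with rfl | hv
        · simp
        · simpa using (hp v hv).le
      add_left := fun v w z => by simp
      smul_left := fun v w z => by simp
      definite := fun v hv => by
        by_contra hne
        exact (hp v hne).ne' hv }
  let _ : NormedAddCommGroup V := c.toNormedAddCommGroup
  let _ : InnerProductSpace ℝ V := InnerProductSpace.ofCore c.toCore
  have : f.IsSymmetric := fun v w => hf v w
  exact this.splits_charpoly

end LinearMap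

/-- The derivative of `σ_{r+1}(A)` is `Tr(T_r(A) dA)`. -/
theorem hasFDerivAt_endSymm {W V : Type*} [NormedAddCommGroup W] [NormedSpace ℝ W]
    [NormedAddCommGroup V] [NormedSpace ℝ V] [FiniteDimensional ℝ V]
    {a : W → V →L[ℝ] V} {x : W} (ha : DifferentiableAt ℝ a x) (r : ℕ) :
    DifferentiableAt ℝ (fun y => endSymm (a y : V →ₗ[ℝ] V) (r + 1)) x ∧
      ∀ v, fderiv ℝ (fun y => endSymm (a y : V →ₗ[ℝ] V) (r + 1)) x v =
        LinearMap.trace ℝ V (endNewton (a x : V →ₗ[ℝ] V) r ∘ₗ (fderiv ℝ a x v : V →ₗ[ℝ] V)) := by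
  classical
  let b := Module.finBasis ℝ V
  let c : Fin (Module.finrank ℝ V) → Fin (Module.finrank ℝ V) → (V →L[ℝ] V) →L[ℝ] ℝ :=
    fun i j => (LinearMap.toContinuousLinearMap (b.coord i)).comp
      (ContinuousLinearMap.apply ℝ V (b j))
  have hc : ∀ (l : V →L[ℝ] V) i j, LinearMap.toMatrix b b (l : V →ₗ[ℝ] V) i j = c i j l := by
    intro l i j
    rw [LinearMap.toMatrix_apply]
    rfl
  have h := hasFDerivAt_matrixSymm (A := fun y => LinearMap.toMatrix b b (a y : V →ₗ[ℝ] V))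
    (A' := fun i j => (c i j).comp (fderiv ℝ a x)) (x := x) (fun i j => by
      simp only [hc]
      exact (c i j).hasFDerivAt.comp x ha.hasFDerivAt) r
  simp only [← endSymm_eq_matrixSymm] at h
  refine ⟨h.differentiableAt, fun v => ?_⟩
  rw [h.fderiv, LinearMap.trace_eq_matrix_trace ℝ b, LinearMap.toMatrix_comp b b b,
    toMatrix_endNewton]
  simp only [trace, diag_apply, mul_apply, _root_.sum_apply, _root_.smul_apply, smul_eq_mul,
    ContinuousLinearMap.comp_apply, hc]

end Algebra

/-! ### The Levi-Civita connection in coordinates, along a map -/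

section Bilinear

variable {V : Type*} [NormedAddCommGroup V] [NormedSpace ℝ V] [FiniteDimensional ℝ V]

theorem isInvertible_of_pos {B : V →L[ℝ] V →L[ℝ] ℝ} (hB : ∀ v, v ≠ 0 → 0 < B v v) :
    B.IsInvertible := by
  have hinj : Function.Injective (B : V →ₗ[ℝ] V →L[ℝ] ℝ) := by
    rw [← LinearMap.ker_eq_bot, LinearMap.ker_eq_bot']
    intro v hv
    by_contra hne
    have h1 : B v = 0 := hv
    have h2 := hB v hne
    rw [h1] at h2
    simp at h2
  have hdim : Module.finrank ℝ V = Module.finrank ℝ (V →L[ℝ] ℝ) := by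
    rw [← (LinearMap.toContinuousLinearMap (𝕜 := ℝ) (E := V) (F' := ℝ)).finrank_eq]
    exact (Subspace.dual_finrank_eq (K := ℝ) (V := V)).symm
  exact ⟨(LinearEquiv.ofInjectiveOfFinrankEq (B : V →ₗ[ℝ] V →L[ℝ] ℝ) hinj
    hdim).toContinuousLinearEquiv, by ext; rfl⟩

theorem eq_of_forall_pos {B : V →L[ℝ] V →L[ℝ] ℝ} (hB : ∀ v, v ≠ 0 → 0 < B v v) {v w : V}
    (h : ∀ c, B v c = B w c) : v = w := by
  by_contra hne
  have h1 := hB (v - w) (sub_ne_zero.mpr hne)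
  rw [map_sub B, _root_.sub_apply, h, sub_self] at h1
  exact lt_irrefl _ h1

end Bilinear

section Smoothness

variable {V W : Type*} [NormedAddCommGroup V] [NormedSpace ℝ V]
  [NormedAddCommGroup W] [NormedSpace ℝ W]

theorem contDiffAt_fderiv {f : V → W} {x : V} (hf : ContDiffAt ℝ ∞ f x) :
    ContDiffAt ℝ ∞ (fderiv ℝ f) x :=
  hf.fderiv_right (by simp)

theorem differentiableAt_of_smooth {f : V → W} {x : V} (hf : ContDiffAt ℝ ∞ f x) :
    DifferentiableAt ℝ f x :=
  hf.differentiableAt (by simp)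

theorem fderiv_fderiv_symm {f : V → W} {x : V} (hf : ContDiffAt ℝ ∞ f x) (v w : V) :
    fderiv ℝ (fderiv ℝ f) x v w = fderiv ℝ (fderiv ℝ f) x w v :=
  hf.isSymmSndFDerivAt (by
    rw [minSmoothness_of_isRCLikeNormedField]
    exact WithTop.coe_le_coe.mpr (le_top : (2 : ℕ∞) ≤ ⊤)) v w

theorem contDiffAt_flip {X : Type*} [NormedAddCommGroup X] [NormedSpace ℝ X]
    {Y : Type*} [NormedAddCommGroup Y] [NormedSpace ℝ Y]
    {f : V → W →L[ℝ] X →L[ℝ] Y} {x : V} (hf : ContDiffAt ℝ ∞ f x) :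
    ContDiffAt ℝ ∞ (fun y => (f y).flip) x :=
  ((ContinuousLinearMap.flipₗᵢ ℝ W X Y).toContinuousLinearEquiv.toContinuousLinearMap).contDiff
    |>.contDiffAt.comp x hf

/-- Derivative of `y ↦ f y w` for a constant vector `w`. -/
theorem fderiv_apply_const {X : Type*} [NormedAddCommGroup X] [NormedSpace ℝ X]
    {f : V → W →L[ℝ] X} {x : V} (hf : DifferentiableAt ℝ f x) (w : W) (v : V) :
    fderiv ℝ (fun y => f y w) x v = fderiv ℝ f x v w := by
  rw [(hf.hasFDerivAt.clm_apply (hasFDerivAt_const w x)).fderiv]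
  simp

/-- Leibniz rule for `y ↦ f y (g y)`. -/
theorem fderiv_apply_apply {X : Type*} [NormedAddCommGroup X] [NormedSpace ℝ X]
    {f : V → W →L[ℝ] X} {g : V → W} {x : V} (hf : DifferentiableAt ℝ f x)
    (hg : DifferentiableAt ℝ g x) (v : V) :
    fderiv ℝ (fun y => f y (g y)) x v = fderiv ℝ f x v (g x) + f x (fderiv ℝ g x v) := by
  rw [(hf.hasFDerivAt.clm_apply hg.hasFDerivAt).fderiv]
  simp [add_comm]

theorem fderiv_comp_fun_apply {X : Type*} [NormedAddCommGroup X] [NormedSpace ℝ X]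
    {f : W → X} {g : V → W} {x : V} (hf : DifferentiableAt ℝ f (g x))
    (hg : DifferentiableAt ℝ g x) (v : V) :
    fderiv ℝ (fun y => f (g y)) x v = fderiv ℝ f (g x) (fderiv ℝ g x v) := by
  have := fderiv_comp x hf hg
  rw [Function.comp_def] at this
  rw [this]; rfl

end Smoothness

section Metric

variable {E : Type*} [NormedAddCommGroup E] [NormedSpace ℝ E] [FiniteDimensional ℝ E]

/-- `G` represents a smooth Riemannian metric on the open subset `V` of the coordinate space. -/
structure IsMetricOn (G : E → E →L[ℝ] E →L[ℝ] ℝ) (V : Set E) : Prop where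
  isOpen : IsOpen V
  contDiffOn : ContDiffOn ℝ ∞ G V
  symm : ∀ y ∈ V, ∀ a b, G y a b = G y b a
  pos : ∀ y ∈ V, ∀ a, a ≠ 0 → 0 < G y a a

variable {G : E → E →L[ℝ] E →L[ℝ] ℝ} {V : Set E} {y : E}

namespace IsMetricOn

theorem contDiffAt (hG : IsMetricOn G V) (hy : y ∈ V) : ContDiffAt ℝ ∞ G y :=
  hG.contDiffOn.contDiffAt (hG.isOpen.mem_nhds hy)

theorem differentiableAt (hG : IsMetricOn G V) (hy : y ∈ V) : DifferentiableAt ℝ G y :=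
  differentiableAt_of_smooth (hG.contDiffAt hy)

theorem isInvertible (hG : IsMetricOn G V) (hy : y ∈ V) : (G y).IsInvertible :=
  isInvertible_of_pos (hG.pos y hy)

theorem ext_left (hG : IsMetricOn G V) (hy : y ∈ V) {a b : E} (h : ∀ c, G y a c = G y b c) :
    a = b :=
  eq_of_forall_pos (hG.pos y hy) h

theorem fderiv_symm (hG : IsMetricOn G V) (hy : y ∈ V) (c a b : E) :
    fderiv ℝ G y c a b = fderiv ℝ G y c b a := by
  have h1 : ∀ a b, fderiv ℝ (fun z => G z a b) y c = fderiv ℝ G y c a b := by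
    intro a b
    rw [fderiv_apply_const (f := fun z => G z a)
      ((hG.differentiableAt hy).clm_apply (differentiableAt_const a)),
      fderiv_apply_const (hG.differentiableAt hy)]
  rw [← h1, ← h1]
  refine congrArg (fun l : E →L[ℝ] ℝ => l c) (Filter.EventuallyEq.fderiv_eq ?_)
  filter_upwards [hG.isOpen.mem_nhds hy] with z hz using hG.symm z hz a b

theorem metric_christoffel (hG : IsMetricOn G V) (hy : y ∈ V) (a b c : E) :
    G y (christoffel G y a b) c = christoffelFirst G y a b c := by
  rw [christoffel_apply, (hG.isInvertible hy).self_apply_inverse]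

theorem christoffel_symm (hG : IsMetricOn G V) (hy : y ∈ V) (a b : E) :
    christoffel G y a b = christoffel G y b a := by
  refine hG.ext_left hy fun c => ?_
  rw [hG.metric_christoffel hy, hG.metric_christoffel hy, christoffelFirst_apply,
    christoffelFirst_apply, hG.fderiv_symm hy c a b]
  ring

theorem fderiv_eq_christoffel (hG : IsMetricOn G V) (hy : y ∈ V) (c a b : E) :
    fderiv ℝ G y c a b = G y (christoffel G y c a) b + G y a (christoffel G y c b) := by
  rw [hG.symm y hy a, hG.metric_christoffel hy, hG.metric_christoffel hy, christoffelFirst_apply,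
    christoffelFirst_apply, hG.fderiv_symm hy c b a, hG.fderiv_symm hy a c b,
    hG.fderiv_symm hy b c a]
  ring

theorem contDiffAt_christoffel (hG : IsMetricOn G V) (hy : y ∈ V) :
    ContDiffAt ℝ ∞ (christoffel G) y := by
  have hD := contDiffAt_fderiv (hG.contDiffAt hy)
  have h1 : ContDiffAt ℝ ∞ (christoffelFirst G) y := by
    unfold christoffelFirst
    refine (contDiffAt_const (c := (1 / 2 : ℝ))).smul ((hD.add (contDiffAt_flip hD)).sub
      (contDiffAt_const.clm_comp (contDiffAt_flip hD)))
  have h2 : ContDiffAt ℝ ∞ (fun z => (G z).inverse) y :=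
    (hG.isInvertible hy).contDiffAt_map_inverse.comp y (hG.contDiffAt hy)
  unfold christoffel
  exact ((ContinuousLinearMap.compL ℝ E (E →L[ℝ] ℝ) E).contDiff.contDiffAt.comp y h2).clm_comp h1

end IsMetricOn

variable {F : Type*} [NormedAddCommGroup F] [NormedSpace ℝ F]

/-- The covariant derivative `v ↦ D_v W = ∂_v W + Γ(∂_v φ, W)` of a vector field `W` along a map
`φ` into a coordinate space with metric `G`. -/
noncomputable def covAlong (G : E → E →L[ℝ] E →L[ℝ] ℝ) (φ W : F → E) (x : F) : F →L[ℝ] E :=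
  fderiv ℝ W x + ((christoffel G (φ x)).flip (W x)).comp (fderiv ℝ φ x)

theorem covAlong_apply (φ W : F → E) (x v : F) :
    covAlong G φ W x v = fderiv ℝ W x v + christoffel G (φ x) (fderiv ℝ φ x v) (W x) :=
  rfl

variable {φ W Z : F → E} {x : F}

namespace IsMetricOn

theorem contDiffAt_covAlong (hG : IsMetricOn G V) (hx : φ x ∈ V) (hφ : ContDiffAt ℝ ∞ φ x)
    (hW : ContDiffAt ℝ ∞ W x) : ContDiffAt ℝ ∞ (covAlong G φ W) x := by
  unfold covAlong
  exact (contDiffAt_fderiv hW).add (((contDiffAt_flip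
    ((hG.contDiffAt_christoffel hx).comp x hφ)).clm_apply hW).clm_comp (contDiffAt_fderiv hφ))

/-- Metric compatibility of the Levi-Civita connection, along a map. -/
theorem fderiv_metric (hG : IsMetricOn G V) (hx : φ x ∈ V) (hφ : DifferentiableAt ℝ φ x)
    (hW : DifferentiableAt ℝ W x) (hZ : DifferentiableAt ℝ Z x) (v : F) :
    fderiv ℝ (fun x => G (φ x) (W x) (Z x)) x v =
      G (φ x) (covAlong G φ W x v) (Z x) + G (φ x) (W x) (covAlong G φ Z x v) := by
  have hGφ : DifferentiableAt ℝ (fun x => G (φ x)) x := (hG.differentiableAt hx).comp x hφ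
  rw [fderiv_apply_apply (f := fun x => G (φ x) (W x)) (hGφ.clm_apply hW) hZ,
    fderiv_apply_apply hGφ hW, fderiv_comp_fun_apply (hG.differentiableAt hx) hφ,
    covAlong_apply, covAlong_apply, _root_.add_apply, hG.fderiv_eq_christoffel hx,
    map_add, map_add, _root_.add_apply]
  ring

theorem differentiableAt_metric (hG : IsMetricOn G V) (hx : φ x ∈ V)
    (hφ : DifferentiableAt ℝ φ x)
    (hW : DifferentiableAt ℝ W x) (hZ : DifferentiableAt ℝ Z x) :
    DifferentiableAt ℝ (fun x => G (φ x) (W x) (Z x)) x :=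
  (((hG.differentiableAt hx).comp x hφ).clm_apply hW).clm_apply hZ

theorem contDiffAt_metric (hG : IsMetricOn G V) (hx : φ x ∈ V)
    (hφ : ContDiffAt ℝ ∞ φ x) (hW : ContDiffAt ℝ ∞ W x) (hZ : ContDiffAt ℝ ∞ Z x) :
    ContDiffAt ℝ ∞ (fun x => G (φ x) (W x) (Z x)) x :=
  (((hG.contDiffAt hx).comp x hφ).clm_apply hW).clm_apply hZ

/-- The Levi-Civita connection has no torsion. -/
theorem covAlong_fderiv_symm (hG : IsMetricOn G V) (hx : φ x ∈ V) (hφ : ContDiffAt ℝ ∞ φ x)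
    (v w : F) :
    covAlong G φ (fun x => fderiv ℝ φ x w) x v = covAlong G φ (fun x => fderiv ℝ φ x v) x w := by
  have hd := differentiableAt_of_smooth (contDiffAt_fderiv hφ)
  rw [covAlong_apply, covAlong_apply, fderiv_apply_const hd, fderiv_apply_const hd,
    fderiv_fderiv_symm hφ v w, hG.christoffel_symm hx]

/-- The commutator of covariant derivatives along a map is the curvature. -/
theorem covAlong_comm (hG : IsMetricOn G V) (hx : φ x ∈ V) (hφ : ContDiffAt ℝ ∞ φ x)
    (hW : ContDiffAt ℝ ∞ W x) (v w : F) :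
    covAlong G φ (fun x => covAlong G φ W x w) x v - covAlong G φ (fun x => covAlong G φ W x v) x w
      = coordCurvature G (φ x) (fderiv ℝ φ x w) (W x) (fderiv ℝ φ x v) := by
  have hdφ := differentiableAt_of_smooth (contDiffAt_fderiv hφ)
  have hdW := differentiableAt_of_smooth (contDiffAt_fderiv hW)
  have hφ' := differentiableAt_of_smooth hφ
  have hW' := differentiableAt_of_smooth hW
  have hΓ := differentiableAt_of_smooth (hG.contDiffAt_christoffel hx)
  have hΓφ : DifferentiableAt ℝ (fun x => christoffel G (φ x)) x := hΓ.comp x hφ'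
  have key : ∀ v w : F, fderiv ℝ (fun x => covAlong G φ W x w) x v =
      fderiv ℝ (fderiv ℝ W) x v w
      + (fderiv ℝ (christoffel G) (φ x) (fderiv ℝ φ x v) (fderiv ℝ φ x w) (W x)
        + christoffel G (φ x) (fderiv ℝ (fderiv ℝ φ) x v w) (W x)
        + christoffel G (φ x) (fderiv ℝ φ x w) (fderiv ℝ W x v)) := by
    intro v w
    simp only [covAlong_apply]
    have hΓw : DifferentiableAt ℝ (fun x => christoffel G (φ x) (fderiv ℝ φ x w)) x :=
      hΓφ.clm_apply (hdφ.clm_apply (differentiableAt_const w))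
    rw [fderiv_fun_add (hdW.clm_apply (differentiableAt_const w)) (hΓw.clm_apply hW'),
      _root_.add_apply, fderiv_apply_const hdW, fderiv_apply_apply hΓw hW',
      fderiv_apply_apply hΓφ (hdφ.clm_apply (differentiableAt_const w)),
      fderiv_apply_const hdφ, fderiv_comp_fun_apply hΓ hφ', _root_.add_apply]
  rw [covAlong_apply φ (fun x => covAlong G φ W x w),
    covAlong_apply φ (fun x => covAlong G φ W x v),
    key, key, coordCurvature_apply,
    fderiv_fderiv_symm hφ v w, fderiv_fderiv_symm hW v w, covAlong_apply, covAlong_apply, map_add,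
    map_add]
  abel

end IsMetricOn

end Metric

/-! ### Symmetries of the curvature, and conformal fields -/

section Curvature

variable {E : Type*} [NormedAddCommGroup E] [NormedSpace ℝ E] [FiniteDimensional ℝ E]
  {G : E → E →L[ℝ] E →L[ℝ] ℝ} {V : Set E} {y : E}

theorem coordCurvature_antisymm (a b c : E) :
    coordCurvature G y b c a = -coordCurvature G y a c b := by
  rw [coordCurvature_apply, coordCurvature_apply]
  abel

namespace IsMetricOn

theorem fderiv_christoffel_symm (hG : IsMetricOn G V) (hy : y ∈ V) (a b c : E) :
    fderiv ℝ (christoffel G) y a b c = fderiv ℝ (christoffel G) y a c b := by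
  have hΓ := differentiableAt_of_smooth (hG.contDiffAt_christoffel hy)
  have h1 : ∀ b c, fderiv ℝ (fun z => christoffel G z b c) y a =
      fderiv ℝ (christoffel G) y a b c := by
    intro b c
    rw [fderiv_apply_const (f := fun z => christoffel G z b)
      (hΓ.clm_apply (differentiableAt_const b)), fderiv_apply_const hΓ]
  rw [← h1, ← h1]
  refine congrArg (fun l : E →L[ℝ] E => l a) (Filter.EventuallyEq.fderiv_eq ?_)
  filter_upwards [hG.isOpen.mem_nhds hy] with z hz using hG.christoffel_symm hz b c

/-- The first Bianchi identity. -/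
theorem bianchi (hG : IsMetricOn G V) (hy : y ∈ V) (a b c : E) :
    coordCurvature G y b c a + coordCurvature G y c a b + coordCurvature G y a b c = 0 := by
  simp only [coordCurvature_apply]
  rw [hG.fderiv_christoffel_symm hy a c b, hG.fderiv_christoffel_symm hy b c a,
    hG.fderiv_christoffel_symm hy c b a, hG.christoffel_symm hy c a, hG.christoffel_symm hy c b,
    hG.christoffel_symm hy b a]
  abel

/-- `R(a, b)` is skew-adjoint: the Hessian of `y ↦ ⟨c, d⟩_y` is symmetric, and covariant
differentiation of that function produces the curvature terms. -/
theorem curvature_skew (hG : IsMetricOn G V) (hy : y ∈ V) (a b c d : E) :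
    G y (coordCurvature G y b c a) d = -G y (coordCurvature G y b d a) c := by
  have hid : ∀ z : E, ContDiffAt ℝ ∞ (fun z : E => z) z := fun z => contDiffAt_id
  have hdid : ∀ z : E, DifferentiableAt ℝ (fun z : E => z) z := fun z => differentiableAt_id
  have hc : ∀ (c : E) {z : E}, z ∈ V → ContDiffAt ℝ ∞ (covAlong G (fun z => z) (fun _ => c)) z :=
    fun c z hz => hG.contDiffAt_covAlong (φ := fun z => z) hz (hid z) contDiffAt_const
  have hcd : ∀ (c a : E) {z : E}, z ∈ V →
      DifferentiableAt ℝ (fun z => covAlong G (fun z => z) (fun _ => c) z a) z :=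
    fun c a z hz => (differentiableAt_of_smooth (hc c hz)).clm_apply (differentiableAt_const a)
  have hs : ContDiffAt ℝ ∞ (fun z => G z c d) y :=
    hG.contDiffAt_metric (φ := fun z => z) hy (hid y) contDiffAt_const contDiffAt_const
  have h2 : ∀ a b : E, fderiv ℝ (fderiv ℝ (fun z => G z c d)) y a b =
      G y (covAlong G (fun z => z) (fun z => covAlong G (fun z => z) (fun _ => c) z b) y a) d
      + G y (covAlong G (fun z => z) (fun _ => c) y b) (covAlong G (fun z => z) (fun _ => d) y a)
      + (G y (covAlong G (fun z => z) (fun _ => c) y a) (covAlong G (fun z => z) (fun _ => d) y b)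
      + G y c (covAlong G (fun z => z) (fun z => covAlong G (fun z => z) (fun _ => d) z b) y a))
      := by
    intro a b
    rw [← fderiv_apply_const (differentiableAt_of_smooth (contDiffAt_fderiv hs)) b a]
    have h1 : (fun z => fderiv ℝ (fun z => G z c d) z b) =ᶠ[nhds y]
        fun z => G z (covAlong G (fun z => z) (fun _ => c) z b) d
          + G z c (covAlong G (fun z => z) (fun _ => d) z b) := by
      filter_upwards [hG.isOpen.mem_nhds hy] with z hz
      exact hG.fderiv_metric (φ := fun z => z) hz (hdid z) (differentiableAt_const c)
        (differentiableAt_const d) b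
    rw [h1.fderiv_eq, fderiv_fun_add
      (hG.differentiableAt_metric (φ := fun z => z) hy (hdid y) (hcd c b hy)
        (differentiableAt_const d))
      (hG.differentiableAt_metric (φ := fun z => z) hy (hdid y) (differentiableAt_const c)
        (hcd d b hy)), _root_.add_apply,
      hG.fderiv_metric (φ := fun z => z) hy (hdid y) (hcd c b hy) (differentiableAt_const d),
      hG.fderiv_metric (φ := fun z => z) hy (hdid y) (differentiableAt_const c) (hcd d b hy)]
  have h3 := fderiv_fderiv_symm hs a b
  rw [h2, h2] at h3
  have hR : ∀ c : E, coordCurvature G y b c a =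
      covAlong G (fun z => z) (fun z => covAlong G (fun z => z) (fun _ => c) z b) y a
      - covAlong G (fun z => z) (fun z => covAlong G (fun z => z) (fun _ => c) z a) y b := by
    intro c
    rw [hG.covAlong_comm (φ := fun z => z) hy (hid y) contDiffAt_const a b]
    simp
  rw [hG.symm y hy _ c, hR c, hR d]
  simp only [map_sub, _root_.sub_apply]
  linarith

/-- The pair symmetry `⟨R(a, b) c, d⟩ = ⟨R(c, d) a, b⟩`. -/
theorem curvature_pair_symm (hG : IsMetricOn G V) (hy : y ∈ V) (a b c d : E) :
    G y (coordCurvature G y b c a) d = G y (coordCurvature G y d a c) b := by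
  have hs := fun a b c d => hG.curvature_skew hy a b c d
  have ha : ∀ a b c d, G y (coordCurvature G y b c a) d = -G y (coordCurvature G y a c b) d := by
    intro a b c d
    rw [coordCurvature_antisymm, map_neg, _root_.neg_apply]
  have hb : ∀ a b c d, G y (coordCurvature G y b c a) d + G y (coordCurvature G y c a b) d
      + G y (coordCurvature G y a b c) d = 0 := by
    intro a b c d
    rw [← _root_.add_apply, ← map_add, ← _root_.add_apply, ← map_add, hG.bianchi hy]
    simp
  linarith [hb a b c d, hb b c d a, hb c d a b, hb d a b c, hs a b c d, hs b c a d, hs c a b d,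
    hs b c d a, hs c d b a, hs d b c a, hs c d a b, hs d a c b, hs a c d b, hs d a b c, hs a b d c,
    hs b d a c, ha a b c d, ha a c b d, ha a d b c, ha b c a d, ha b d a c, ha c d a b,
    ha a b d c, ha a c d b, ha a d c b, ha b c d a, ha b d c a, ha c d b a]

end IsMetricOn

end Curvature

section Conformal

variable {E : Type*} [NormedAddCommGroup E] [NormedSpace ℝ E] [FiniteDimensional ℝ E]
  {G : E → E →L[ℝ] E →L[ℝ] ℝ} {V : Set E} {y : E} {u : E → E} {κ : E → ℝ}

/-- The covariant derivative `a ↦ ∇_a u` of a vector field in coordinates. -/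
noncomputable def covField (G : E → E →L[ℝ] E →L[ℝ] ℝ) (u : E → E) (y : E) : E →L[ℝ] E :=
  covAlong G (fun z => z) u y

theorem covField_apply (a : E) :
    covField G u y a = fderiv ℝ u y a + christoffel G y a (u y) := by
  rw [covField, covAlong_apply]
  simp

/-- The second covariant derivative `∇²_{c,a} u = (∇_c (∇ u))(a)`. -/
noncomputable def covField₂ (G : E → E →L[ℝ] E →L[ℝ] ℝ) (u : E → E) (y c a : E) : E :=
  covAlong G (fun z => z) (fun z => covField G u z a) y c - covField G u y (christoffel G y c a)

/-- The Lie derivative of the metric is the symmetric part of the covariant derivative. -/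
theorem IsMetricOn.coordLieDerivMetric_eq (hG : IsMetricOn G V) (hy : y ∈ V) (u : E → E)
    (a b : E) : coordLieDerivMetric G u y a b =
      G y (covField G u y a) b + G y a (covField G u y b) := by
  rw [coordLieDerivMetric, hG.fderiv_eq_christoffel hy, covField_apply,
    covField_apply, map_add, map_add, _root_.add_apply, hG.christoffel_symm hy a,
    hG.christoffel_symm hy b]
  ring

/-- `u` is, on `V`, a smooth conformal field with factor `2κ` for the metric `G`. -/
structure IsConformalOn (G : E → E →L[ℝ] E →L[ℝ] ℝ) (u : E → E) (κ : E → ℝ) (V : Set E) :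
    Prop where
  contDiffAt_field : ∀ y ∈ V, ContDiffAt ℝ ∞ u y
  contDiffAt_factor : ∀ y ∈ V, ContDiffAt ℝ ∞ κ y
  lieDeriv : ∀ y ∈ V, ∀ a b, coordLieDerivMetric G u y a b = 2 * κ y * G y a b

namespace IsConformalOn

/-- `∇u` is `κ` times the identity plus a skew-adjoint endomorphism. -/
theorem covField_add (hu : IsConformalOn G u κ V) (hG : IsMetricOn G V) (hy : y ∈ V) (a b : E) :
    G y (covField G u y a) b + G y a (covField G u y b) = 2 * κ y * G y a b := by
  rw [← hu.lieDeriv y hy, hG.coordLieDerivMetric_eq hy]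

theorem contDiffAt_covField (hu : IsConformalOn G u κ V) (hG : IsMetricOn G V) (hy : y ∈ V) :
    ContDiffAt ℝ ∞ (covField G u) y :=
  hG.contDiffAt_covAlong (φ := fun z => z) hy contDiffAt_id (hu.contDiffAt_field y hy)

theorem covField₂_add (hu : IsConformalOn G u κ V) (hG : IsMetricOn G V) (hy : y ∈ V)
    (c a b : E) :
    G y (covField₂ G u y c a) b + G y (covField₂ G u y c b) a =
      2 * fderiv ℝ κ y c * G y a b := by
  have hdid : DifferentiableAt ℝ (fun z : E => z) y := differentiableAt_id
  have hB := differentiableAt_of_smooth (hu.contDiffAt_covField hG hy)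
  have hBa : ∀ a, DifferentiableAt ℝ (fun z => covField G u z a) y :=
    fun a => hB.clm_apply (differentiableAt_const a)
  have hκ := differentiableAt_of_smooth (hu.contDiffAt_factor y hy)
  have h1 : (fun z => G z (covField G u z a) b + G z a (covField G u z b)) =ᶠ[nhds y]
      fun z => 2 * κ z * G z a b := by
    filter_upwards [hG.isOpen.mem_nhds hy] with z hz using hu.covField_add hG hz a b
  have h2 := congrArg (fun l : E →L[ℝ] ℝ => l c) h1.fderiv_eq
  have hGab : DifferentiableAt ℝ (fun z => G z a b) y :=
    hG.differentiableAt_metric (φ := fun z => z) hy hdid (differentiableAt_const a)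
      (differentiableAt_const b)
  have hΓ : ∀ a, covAlong G (fun z => z) (fun _ => a) y c = christoffel G y c a := by
    intro a
    rw [covAlong_apply]
    simp
  beta_reduce at h2
  rw [fderiv_fun_add
    (hG.differentiableAt_metric (φ := fun z => z) hy hdid (hBa a) (differentiableAt_const b))
    (hG.differentiableAt_metric (φ := fun z => z) hy hdid (differentiableAt_const a) (hBa b)),
    _root_.add_apply,
    hG.fderiv_metric (φ := fun z => z) hy hdid (hBa a) (differentiableAt_const b),
    hG.fderiv_metric (φ := fun z => z) hy hdid (differentiableAt_const a) (hBa b),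
    fderiv_fun_mul (hκ.const_mul 2) hGab, _root_.add_apply, _root_.smul_apply, _root_.smul_apply,
    hG.fderiv_metric (φ := fun z => z) hy hdid (differentiableAt_const a)
      (differentiableAt_const b), fderiv_const_mul hκ, _root_.smul_apply, hΓ, hΓ] at h2
  have h3 := hu.covField_add hG hy a (christoffel G y c b)
  have h4 := hu.covField_add hG hy (christoffel G y c a) b
  simp only [smul_eq_mul] at h2
  rw [covField₂, covField₂, map_sub, map_sub, _root_.sub_apply, _root_.sub_apply,
    hG.symm y hy _ a, hG.symm y hy _ a]
  linarith

theorem covField₂_sub (hu : IsConformalOn G u κ V) (hG : IsMetricOn G V) (hy : y ∈ V)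
    (c a : E) : covField₂ G u y c a - covField₂ G u y a c = coordCurvature G y a (u y) c := by
  have h := hG.covAlong_comm (φ := fun z => z) hy contDiffAt_id (hu.contDiffAt_field y hy) c a
  rw [covField₂, covField₂, hG.christoffel_symm hy c a, sub_sub_sub_cancel_right]
  simpa [covField] using h

/-- The second covariant derivative of a conformal field is determined by the curvature and the
gradient of the conformal factor:
`⟨∇²_{c,a} u, b⟩ = dκ(c) ⟨a, b⟩ + dκ(a) ⟨b, c⟩ - dκ(b) ⟨c, a⟩ - ⟨R(b, a) c, u⟩`. -/
theorem covField₂_eq (hu : IsConformalOn G u κ V) (hG : IsMetricOn G V) (hy : y ∈ V)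
    (c a b : E) :
    G y (covField₂ G u y c a) b =
      fderiv ℝ κ y c * G y a b + fderiv ℝ κ y a * G y b c - fderiv ℝ κ y b * G y c a
        - G y (coordCurvature G y a c b) (u y) := by
  have hadd := fun c a b => hu.covField₂_add hG hy c a b
  have hsub : ∀ c a b, G y (covField₂ G u y c a) b - G y (covField₂ G u y a c) b =
      -G y (coordCurvature G y a b c) (u y) := by
    intro c a b
    rw [← _root_.sub_apply, ← map_sub, hu.covField₂_sub hG hy, hG.curvature_skew hy]
  have hb : G y (coordCurvature G y a c b) (u y) + G y (coordCurvature G y c b a) (u y)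
      + G y (coordCurvature G y b a c) (u y) = 0 := by
    rw [← _root_.add_apply, ← map_add, ← _root_.add_apply, ← map_add, hG.bianchi hy]
    simp
  have ha : ∀ a b c d, G y (coordCurvature G y b c a) d = -G y (coordCurvature G y a c b) d := by
    intro a b c d
    rw [coordCurvature_antisymm, map_neg, _root_.neg_apply]
  linarith [hadd c a b, hsub c b a, hadd b c a, hsub b a c, hadd a b c, hsub a c b,
    hG.symm y hy a b, hG.symm y hy b c, hG.symm y hy c a, ha c a b (u y), ha a b c (u y),
    ha b c a (u y)]

end IsConformalOn

end Conformal

/-! ### Hypersurfaces in coordinates -/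

section LocalHypersurface

variable {E : Type*} [NormedAddCommGroup E] [NormedSpace ℝ E] [FiniteDimensional ℝ E]
  {F : Type*} [NormedAddCommGroup F] [NormedSpace ℝ F] [FiniteDimensional ℝ F]

/-- The metric `h` induced on the parameter space by the map `φ`. -/
noncomputable def pullMetric (G : E → E →L[ℝ] E →L[ℝ] ℝ) (φ : F → E) (x : F) :
    F →L[ℝ] F →L[ℝ] ℝ :=
  ((fderiv ℝ φ x).precomp ℝ).comp ((G (φ x)).comp (fderiv ℝ φ x))

/-- The tangential part of a vector along `φ`, in the parameter space. -/
noncomputable def tanPart (G : E → E →L[ℝ] E →L[ℝ] ℝ) (φ : F → E) (x : F) : E →L[ℝ] F :=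
  (pullMetric G φ x).inverse.comp (((fderiv ℝ φ x).precomp ℝ).comp (G (φ x)))

/-- The shape operator in coordinates. -/
noncomputable def coordShape (G : E → E →L[ℝ] E →L[ℝ] ℝ) (φ ν : F → E) (x : F) : F →L[ℝ] F :=
  -(tanPart G φ x).comp (covAlong G φ ν x)

/-- The gradient in coordinates, for the induced metric. -/
noncomputable def coordGrad (G : E → E →L[ℝ] E →L[ℝ] ℝ) (φ : F → E) (f : F → ℝ) (x : F) : F :=
  (pullMetric G φ x).inverse (fderiv ℝ f x)

/-- The Hessian `v ↦ (D_v ∇f)^⊤` in coordinates. -/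
noncomputable def coordHess (G : E → E →L[ℝ] E →L[ℝ] ℝ) (φ : F → E) (f : F → ℝ) (x : F) :
    F →L[ℝ] F :=
  (tanPart G φ x).comp (covAlong G φ (fun x => fderiv ℝ φ x (coordGrad G φ f x)) x)

/-- The map `φ` on the open set `O` is a hypersurface, immersed into the coordinate domain `V`
with metric `G`, and `ν` is a unit normal field along it. -/
structure IsHypersurfaceOn (G : E → E →L[ℝ] E →L[ℝ] ℝ) (V : Set E) (φ ν : F → E) (O : Set F) :
    Prop where
  metric : IsMetricOn G V
  finrank_eq : Module.finrank ℝ E = Module.finrank ℝ F + 1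
  isOpen : IsOpen O
  mem : ∀ x ∈ O, φ x ∈ V
  contDiffAt_map : ∀ x ∈ O, ContDiffAt ℝ ∞ φ x
  injective : ∀ x ∈ O, Function.Injective (fderiv ℝ φ x)
  contDiffAt_normal : ∀ x ∈ O, ContDiffAt ℝ ∞ ν x
  normal : ∀ x ∈ O, ∀ v, G (φ x) (ν x) (fderiv ℝ φ x v) = 0
  unit : ∀ x ∈ O, G (φ x) (ν x) (ν x) = 1

variable {G : E → E →L[ℝ] E →L[ℝ] ℝ} {V : Set E} {φ ν : F → E} {O : Set F} {x : F}

theorem pullMetric_apply (v w : F) :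
    pullMetric G φ x v w = G (φ x) (fderiv ℝ φ x v) (fderiv ℝ φ x w) :=
  rfl

theorem covAlong_map_apply {Z : F → F}
    (hφ : DifferentiableAt ℝ (fderiv ℝ φ) x) (hZ : DifferentiableAt ℝ Z x) (v : F) :
    covAlong G φ (fun x => fderiv ℝ φ x (Z x)) x v =
      fderiv ℝ φ x (fderiv ℝ Z x v) + covAlong G φ (fun x' => fderiv ℝ φ x' (Z x)) x v := by
  rw [covAlong_apply, covAlong_apply, fderiv_apply_apply hφ hZ, fderiv_apply_const hφ]
  abel

namespace IsHypersurfaceOn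

variable (H : IsHypersurfaceOn G V φ ν O) (hx : x ∈ O)
include H hx

theorem metric_symm (a b : E) : G (φ x) a b = G (φ x) b a :=
  H.metric.symm _ (H.mem x hx) a b

theorem pullMetric_symm (v w : F) : pullMetric G φ x v w = pullMetric G φ x w v := by
  rw [pullMetric_apply, pullMetric_apply, H.metric_symm hx]

theorem pullMetric_pos (v : F) (hv : v ≠ 0) : 0 < pullMetric G φ x v v :=
  H.metric.pos _ (H.mem x hx) _ fun h =>
    hv (H.injective x hx (h.trans (map_zero (fderiv ℝ φ x)).symm))

theorem isInvertible : (pullMetric G φ x).IsInvertible :=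
  isInvertible_of_pos (H.pullMetric_pos hx)

theorem ext_left {v w : F} (h : ∀ c, pullMetric G φ x v c = pullMetric G φ x w c) : v = w :=
  eq_of_forall_pos (H.pullMetric_pos hx) h

theorem pullMetric_tanPart (e : E) (w : F) :
    pullMetric G φ x (tanPart G φ x e) w = G (φ x) e (fderiv ℝ φ x w) := by
  rw [tanPart, ContinuousLinearMap.comp_apply, (H.isInvertible hx).self_apply_inverse]
  rfl

theorem pullMetric_coordGrad (f : F → ℝ) (w : F) :
    pullMetric G φ x (coordGrad G φ f x) w = fderiv ℝ f x w := by
  rw [coordGrad, (H.isInvertible hx).self_apply_inverse]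

/-- The ambient space splits orthogonally into the tangent hyperplane and the normal line. -/
theorem decomp (e : E) : e = fderiv ℝ φ x (tanPart G φ x e) + G (φ x) e (ν x) • ν x := by
  let T : F × ℝ →ₗ[ℝ] E := (fderiv ℝ φ x : F →ₗ[ℝ] E).coprod (LinearMap.toSpanSingleton ℝ E (ν x))
  have hT : ∀ v s, T (v, s) = fderiv ℝ φ x v + s • ν x := fun v s => by simp [T]
  have hn : ∀ v s, G (φ x) (fderiv ℝ φ x v + s • ν x) (ν x) = s := by
    intro v s
    rw [map_add, _root_.add_apply, H.metric_symm hx, H.normal x hx, map_smul, _root_.smul_apply,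
      H.unit x hx]
    simp
  have hinj : Function.Injective T := by
    rw [← LinearMap.ker_eq_bot, LinearMap.ker_eq_bot']
    rintro ⟨v, s⟩ h0
    rw [hT] at h0
    have hs : s = 0 := by rw [← hn v s, h0]; simp
    rw [hs, zero_smul, add_zero] at h0
    have hv : v = 0 := H.injective x hx (by rw [h0, map_zero])
    rw [hv, hs]; rfl
  have hsurj : Function.Surjective T :=
    (LinearMap.injective_iff_surjective_of_finrank_eq_finrank (by
      rw [Module.finrank_prod, Module.finrank_self, H.finrank_eq])).mp hinj
  obtain ⟨⟨v, s⟩, rfl⟩ := hsurj e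
  rw [hT, hn]
  congr 2
  refine H.ext_left hx fun c => ?_
  rw [H.pullMetric_tanPart hx, map_add, _root_.add_apply, map_smul, _root_.smul_apply,
    H.normal x hx, pullMetric_apply]
  simp

theorem differentiableAt_map : DifferentiableAt ℝ φ x :=
  differentiableAt_of_smooth (H.contDiffAt_map x hx)

theorem differentiableAt_normal : DifferentiableAt ℝ ν x :=
  differentiableAt_of_smooth (H.contDiffAt_normal x hx)

theorem contDiffAt_fderiv_map : ContDiffAt ℝ ∞ (fderiv ℝ φ) x :=
  contDiffAt_fderiv (H.contDiffAt_map x hx)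

theorem contDiffAt_precomp :
    ContDiffAt ℝ ∞ (fun x => ((fderiv ℝ φ x).precomp ℝ : (E →L[ℝ] ℝ) →L[ℝ] F →L[ℝ] ℝ)) x :=
  (ContinuousLinearMap.compL ℝ F E ℝ).flip.contDiff.contDiffAt.comp x (H.contDiffAt_fderiv_map hx)

theorem contDiffAt_metric : ContDiffAt ℝ ∞ (fun x => G (φ x)) x :=
  (H.metric.contDiffAt (H.mem x hx)).comp x (H.contDiffAt_map x hx)

theorem contDiffAt_pullMetric : ContDiffAt ℝ ∞ (pullMetric G φ) x :=
  (H.contDiffAt_precomp hx).clm_comp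
    ((H.contDiffAt_metric hx).clm_comp (H.contDiffAt_fderiv_map hx))

theorem contDiffAt_inverse : ContDiffAt ℝ ∞ (fun x => (pullMetric G φ x).inverse) x :=
  (H.isInvertible hx).contDiffAt_map_inverse.comp x (H.contDiffAt_pullMetric hx)

theorem contDiffAt_tanPart : ContDiffAt ℝ ∞ (tanPart G φ) x :=
  (H.contDiffAt_inverse hx).clm_comp
    ((H.contDiffAt_precomp hx).clm_comp (H.contDiffAt_metric hx))

theorem contDiffAt_covAlong {W : F → E} (hW : ContDiffAt ℝ ∞ W x) :
    ContDiffAt ℝ ∞ (covAlong G φ W) x :=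
  H.metric.contDiffAt_covAlong (H.mem x hx) (H.contDiffAt_map x hx) hW

theorem contDiffAt_coordShape : ContDiffAt ℝ ∞ (coordShape G φ ν) x :=
  ((H.contDiffAt_tanPart hx).clm_comp
    (H.contDiffAt_covAlong hx (H.contDiffAt_normal x hx))).neg

theorem contDiffAt_coordGrad {f : F → ℝ} (hf : ContDiffAt ℝ ∞ f x) :
    ContDiffAt ℝ ∞ (coordGrad G φ f) x :=
  (H.contDiffAt_inverse hx).clm_apply (contDiffAt_fderiv hf)

theorem fderiv_metric {W Z : F → E} (hW : DifferentiableAt ℝ W x) (hZ : DifferentiableAt ℝ Z x)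
    (v : F) : fderiv ℝ (fun x => G (φ x) (W x) (Z x)) x v =
      G (φ x) (covAlong G φ W x v) (Z x) + G (φ x) (W x) (covAlong G φ Z x v) :=
  H.metric.fderiv_metric (H.mem x hx) (H.differentiableAt_map hx) hW hZ v

theorem differentiableAt_fderiv_map_apply (w : F) :
    DifferentiableAt ℝ (fun x => fderiv ℝ φ x w) x :=
  (differentiableAt_of_smooth (H.contDiffAt_fderiv_map hx)).clm_apply (differentiableAt_const w)

theorem metric_covAlong_normal (v : F) : G (φ x) (covAlong G φ ν x v) (ν x) = 0 := by
  have h1 : (fun x => G (φ x) (ν x) (ν x)) =ᶠ[nhds x] fun _ => (1 : ℝ) := by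
    filter_upwards [H.isOpen.mem_nhds hx] with z hz using H.unit z hz
  have h2 := congrArg (fun l : F →L[ℝ] ℝ => l v) h1.fderiv_eq
  beta_reduce at h2
  rw [H.fderiv_metric hx (H.differentiableAt_normal hx) (H.differentiableAt_normal hx),
    H.metric_symm hx (ν x)] at h2
  simp only [fderiv_fun_const, Pi.zero_apply, _root_.zero_apply] at h2
  linarith

/-- The Weingarten formula `D_v ν = -∂φ(A v)`. -/
theorem covAlong_normal (v : F) :
    covAlong G φ ν x v = -fderiv ℝ φ x (coordShape G φ ν x v) := by
  rw [H.decomp hx (covAlong G φ ν x v), H.metric_covAlong_normal hx, zero_smul, add_zero,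
    coordShape]
  simp

/-- The second fundamental form, through the derivative of the normal field. -/
theorem pullMetric_coordShape (v w : F) :
    pullMetric G φ x (coordShape G φ ν x v) w =
      -G (φ x) (covAlong G φ ν x v) (fderiv ℝ φ x w) := by
  rw [H.covAlong_normal hx, map_neg, _root_.neg_apply, neg_neg, pullMetric_apply]

/-- The second fundamental form, through the second derivatives of the immersion. -/
theorem pullMetric_coordShape_eq (v w : F) :
    pullMetric G φ x (coordShape G φ ν x v) w =
      G (φ x) (ν x) (covAlong G φ (fun x => fderiv ℝ φ x w) x v) := by
  have h1 : (fun x => G (φ x) (ν x) (fderiv ℝ φ x w)) =ᶠ[nhds x] fun _ => (0 : ℝ) := by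
    filter_upwards [H.isOpen.mem_nhds hx] with z hz using H.normal z hz w
  have h2 := congrArg (fun l : F →L[ℝ] ℝ => l v) h1.fderiv_eq
  beta_reduce at h2
  rw [H.fderiv_metric hx (H.differentiableAt_normal hx)
    (H.differentiableAt_fderiv_map_apply hx w)] at h2
  simp only [fderiv_fun_const, Pi.zero_apply, _root_.zero_apply] at h2
  rw [H.pullMetric_coordShape hx]
  linarith

theorem coordShape_symm (v w : F) :
    pullMetric G φ x (coordShape G φ ν x v) w = pullMetric G φ x v (coordShape G φ ν x w) := by
  rw [H.pullMetric_symm hx v, H.pullMetric_coordShape_eq hx, H.pullMetric_coordShape_eq hx,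
    H.metric.covAlong_fderiv_symm (H.mem x hx) (H.contDiffAt_map x hx)]

end IsHypersurfaceOn

/-- The Christoffel symbols `Ξ(v, w)` of the induced connection: the tangential part of
`D_v (∂_w φ)`. -/
noncomputable def inducedChristoffel (G : E → E →L[ℝ] E →L[ℝ] ℝ) (φ : F → E) (x v w : F) : F :=
  tanPart G φ x (covAlong G φ (fun x => fderiv ℝ φ x w) x v)

namespace IsHypersurfaceOn

variable (H : IsHypersurfaceOn G V φ ν O) (hx : x ∈ O)
include H hx

/-- The Gauss formula. -/
theorem covAlong_fderiv (v w : F) :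
    covAlong G φ (fun x => fderiv ℝ φ x w) x v =
      fderiv ℝ φ x (inducedChristoffel G φ x v w)
        + pullMetric G φ x (coordShape G φ ν x v) w • ν x := by
  rw [H.pullMetric_coordShape_eq hx, H.metric_symm hx (ν x)]
  exact H.decomp hx _

theorem inducedChristoffel_symm (v w : F) :
    inducedChristoffel G φ x v w = inducedChristoffel G φ x w v := by
  rw [inducedChristoffel, H.metric.covAlong_fderiv_symm (H.mem x hx) (H.contDiffAt_map x hx)]
  rfl

theorem inducedChristoffel_add (v w w' : F) :
    inducedChristoffel G φ x v (w + w') =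
      inducedChristoffel G φ x v w + inducedChristoffel G φ x v w' := by
  rw [H.inducedChristoffel_symm hx v, H.inducedChristoffel_symm hx v w,
    H.inducedChristoffel_symm hx v w', inducedChristoffel, inducedChristoffel, inducedChristoffel,
    map_add, map_add]

theorem inducedChristoffel_smul (v w : F) (c : ℝ) :
    inducedChristoffel G φ x v (c • w) = c • inducedChristoffel G φ x v w := by
  rw [H.inducedChristoffel_symm hx v, H.inducedChristoffel_symm hx v w,
    inducedChristoffel, inducedChristoffel, map_smul, map_smul]

/-- `⟨Hess f (v), w⟩ = ∂_v ∂_w f - ∂_{Ξ(v, w)} f`. -/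
theorem pullMetric_coordHess {f : F → ℝ} (hf : ContDiffAt ℝ ∞ f x) (v w : F) :
    pullMetric G φ x (coordHess G φ f x v) w =
      fderiv ℝ (fderiv ℝ f) x v w - fderiv ℝ f x (inducedChristoffel G φ x v w) := by
  have hZ := differentiableAt_of_smooth (H.contDiffAt_coordGrad hx hf)
  have hφ := differentiableAt_of_smooth (H.contDiffAt_fderiv_map hx)
  have h1 : (fun x => G (φ x) (fderiv ℝ φ x (coordGrad G φ f x)) (fderiv ℝ φ x w)) =ᶠ[nhds x]
      fun x => fderiv ℝ f x w := by
    filter_upwards [H.isOpen.mem_nhds hx] with z hz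
    exact H.pullMetric_coordGrad hz f w
  have h2 := congrArg (fun l : F →L[ℝ] ℝ => l v) h1.fderiv_eq
  beta_reduce at h2
  rw [H.fderiv_metric hx (hφ.clm_apply hZ) (H.differentiableAt_fderiv_map_apply hx w),
    fderiv_apply_const (differentiableAt_of_smooth (contDiffAt_fderiv hf)),
    H.metric_symm hx (fderiv ℝ φ x (coordGrad G φ f x))] at h2
  have h3 := H.pullMetric_tanPart hx (covAlong G φ (fun x => fderiv ℝ φ x w) x v)
    (coordGrad G φ f x)
  rw [H.pullMetric_symm hx, H.pullMetric_coordGrad hx] at h3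
  rw [coordHess, ContinuousLinearMap.comp_apply, H.pullMetric_tanPart hx, inducedChristoffel]
  linarith

end IsHypersurfaceOn

end LocalHypersurface

/-! ### The Hessian of the support function -/

section LocalFormula

variable {E : Type*} [NormedAddCommGroup E] [NormedSpace ℝ E] [FiniteDimensional ℝ E]
  {F : Type*} [NormedAddCommGroup F] [NormedSpace ℝ F] [FiniteDimensional ℝ F]
  {G : E → E →L[ℝ] E →L[ℝ] ℝ} {V : Set E} {φ ν : F → E} {O : Set F} {x : F}

theorem covAlong_congr {W W' : F → E} (h : W =ᶠ[nhds x] W') :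
    covAlong G φ W x = covAlong G φ W' x := by
  rw [covAlong, covAlong, h.fderiv_eq, h.eq_of_nhds]

theorem covAlong_neg {W : F → E} : covAlong G φ (fun x => -W x) x = -covAlong G φ W x := by
  ext v
  rw [_root_.neg_apply, covAlong_apply, covAlong_apply, fderiv_fun_neg, map_neg,
    _root_.neg_apply, neg_add]

/-- The second covariant derivative `D²_{v,w} ν = D_v D_w ν - D_{Ξ(v, w)} ν` of the normal field. -/
noncomputable def normalSecond (G : E → E →L[ℝ] E →L[ℝ] ℝ) (φ ν : F → E) (x v w : F) : E :=
  covAlong G φ (fun x => covAlong G φ ν x w) x v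
    - covAlong G φ ν x (inducedChristoffel G φ x v w)

/-- The covariant derivative `∇_v A` of the shape operator, for the induced connection. -/
noncomputable def covShape (G : E → E →L[ℝ] E →L[ℝ] ℝ) (φ ν : F → E) (x v w : F) : F :=
  fderiv ℝ (coordShape G φ ν) x v w + inducedChristoffel G φ x v (coordShape G φ ν x w)
    - coordShape G φ ν x (inducedChristoffel G φ x v w)

namespace IsHypersurfaceOn

variable (H : IsHypersurfaceOn G V φ ν O) (hx : x ∈ O)
include H hx

theorem differentiableAt_covAlong_normal (w : F) :
    DifferentiableAt ℝ (fun x => covAlong G φ ν x w) x :=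
  (differentiableAt_of_smooth (H.contDiffAt_covAlong hx (H.contDiffAt_normal x hx))).clm_apply
    (differentiableAt_const w)

theorem normalSecond_sub (v w : F) :
    normalSecond G φ ν x v w - normalSecond G φ ν x w v =
      coordCurvature G (φ x) (fderiv ℝ φ x w) (ν x) (fderiv ℝ φ x v) := by
  rw [normalSecond, normalSecond, H.inducedChristoffel_symm hx v w, sub_sub_sub_cancel_right]
  exact H.metric.covAlong_comm (H.mem x hx) (H.contDiffAt_map x hx) (H.contDiffAt_normal x hx) v w

/-- `∇_v A` through the second covariant derivative of the normal field. -/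
theorem normalSecond_eq (v w : F) :
    normalSecond G φ ν x v w = -fderiv ℝ φ x (covShape G φ ν x v w)
      - pullMetric G φ x (coordShape G φ ν x v) (coordShape G φ ν x w) • ν x := by
  have h1 : (fun x => covAlong G φ ν x w) =ᶠ[nhds x]
      fun x => -fderiv ℝ φ x (coordShape G φ ν x w) := by
    filter_upwards [H.isOpen.mem_nhds hx] with z hz using H.covAlong_normal hz w
  have ha := differentiableAt_of_smooth (H.contDiffAt_coordShape hx)
  rw [normalSecond, covAlong_congr h1, covAlong_neg, _root_.neg_apply,
    covAlong_map_apply (differentiableAt_of_smooth (H.contDiffAt_fderiv_map hx))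
      (ha.clm_apply (differentiableAt_const w)), fderiv_apply_const ha,
    H.covAlong_fderiv hx, H.covAlong_normal hx, covShape, map_sub, map_add]
  abel

theorem metric_normalSecond_normal (v w : F) :
    G (φ x) (normalSecond G φ ν x v w) (ν x) =
      -pullMetric G φ x (coordShape G φ ν x v) (coordShape G φ ν x w) := by
  rw [H.normalSecond_eq hx, H.metric_symm hx, map_sub, map_neg, H.normal x hx, map_smul,
    H.unit x hx]
  simp

theorem metric_normalSecond_tangent (v w c : F) :
    G (φ x) (normalSecond G φ ν x v w) (fderiv ℝ φ x c) =
      -pullMetric G φ x (covShape G φ ν x v w) c := by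
  rw [H.normalSecond_eq hx, map_sub, map_neg, map_smul, _root_.sub_apply, _root_.neg_apply,
    _root_.smul_apply, H.normal x hx, smul_zero, sub_zero]
  rfl

/-- `∇_v A` is self-adjoint. -/
theorem pullMetric_covShape_symm (v w c : F) :
    pullMetric G φ x (covShape G φ ν x v w) c = pullMetric G φ x (covShape G φ ν x v c) w := by
  have hD : ∀ w c, fderiv ℝ (fun x => G (φ x) (covAlong G φ ν x w) (fderiv ℝ φ x c)) x v =
      -pullMetric G φ x (covShape G φ ν x v w) c
        - pullMetric G φ x (coordShape G φ ν x (inducedChristoffel G φ x v w)) c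
        - pullMetric G φ x (coordShape G φ ν x w) (inducedChristoffel G φ x v c) := by
    intro w c
    rw [H.fderiv_metric hx (H.differentiableAt_covAlong_normal hx w)
      (H.differentiableAt_fderiv_map_apply hx c), ← H.metric_normalSecond_tangent hx, normalSecond,
      H.pullMetric_coordShape hx (inducedChristoffel G φ x v w), map_sub, _root_.sub_apply,
      H.covAlong_normal hx w, map_neg, _root_.neg_apply, H.metric_symm hx (fderiv ℝ φ x _),
      H.pullMetric_symm hx (coordShape G φ ν x w), 
      show inducedChristoffel G φ x v c =
        tanPart G φ x (covAlong G φ (fun x => fderiv ℝ φ x c) x v) from rfl,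
      H.pullMetric_tanPart hx]
    ring
  have h1 : (fun x => G (φ x) (covAlong G φ ν x w) (fderiv ℝ φ x c)) =ᶠ[nhds x]
      fun x => G (φ x) (covAlong G φ ν x c) (fderiv ℝ φ x w) := by
    filter_upwards [H.isOpen.mem_nhds hx] with z hz
    have h := H.coordShape_symm hz w c
    rw [H.pullMetric_symm hz w, H.pullMetric_coordShape hz, H.pullMetric_coordShape hz] at h
    linarith
  have h2 := congrArg (fun l : F →L[ℝ] ℝ => l v) h1.fderiv_eq
  beta_reduce at h2
  rw [hD, hD, H.coordShape_symm hx (inducedChristoffel G φ x v w),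
    H.coordShape_symm hx (inducedChristoffel G φ x v c),
    H.pullMetric_symm hx _ (coordShape G φ ν x c),
    H.pullMetric_symm hx _ (coordShape G φ ν x w)] at h2
  linarith

/-- The Codazzi equation. -/
theorem pullMetric_covShape_sub (v w c : F) :
    pullMetric G φ x (covShape G φ ν x v w) c - pullMetric G φ x (covShape G φ ν x w v) c =
      -G (φ x) (coordCurvature G (φ x) (fderiv ℝ φ x w) (ν x) (fderiv ℝ φ x v))
        (fderiv ℝ φ x c) := by
  rw [← H.normalSecond_sub hx, map_sub, _root_.sub_apply, H.metric_normalSecond_tangent hx,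
    H.metric_normalSecond_tangent hx]
  ring

end IsHypersurfaceOn

/-! ### The support function of a conformal field -/

/-- The support function `⟨u, ν⟩`. -/
noncomputable def supportFunction (G : E → E →L[ℝ] E →L[ℝ] ℝ) (φ ν : F → E) (u : E → E)
    (x : F) : ℝ :=
  G (φ x) (u (φ x)) (ν x)

variable {u : E → E} {κ : E → ℝ}

section Support

variable (H : IsHypersurfaceOn G V φ ν O) (hu : IsConformalOn G u κ V) (hx : x ∈ O)
include H hu hx

theorem contDiffAt_conformal_comp : ContDiffAt ℝ ∞ (fun x => u (φ x)) x :=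
  (hu.contDiffAt_field _ (H.mem x hx)).comp x (H.contDiffAt_map x hx)

theorem contDiffAt_supportFunction : ContDiffAt ℝ ∞ (supportFunction G φ ν u) x :=
  H.metric.contDiffAt_metric (H.mem x hx) (H.contDiffAt_map x hx)
    (contDiffAt_conformal_comp H hu hx) (H.contDiffAt_normal x hx)

theorem covAlong_conformal (v : F) :
    covAlong G φ (fun x => u (φ x)) x v = covField G u (φ x) (fderiv ℝ φ x v) := by
  rw [covAlong_apply, covField_apply, fderiv_comp_fun_apply
    (differentiableAt_of_smooth (hu.contDiffAt_field _ (H.mem x hx))) (H.differentiableAt_map hx)]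

theorem fderiv_supportFunction (w : F) :
    fderiv ℝ (supportFunction G φ ν u) x w = G (φ x) (covField G u (φ x) (fderiv ℝ φ x w)) (ν x)
      + G (φ x) (u (φ x)) (covAlong G φ ν x w) := by
  rw [← covAlong_conformal H hu hx]
  exact H.fderiv_metric hx (differentiableAt_of_smooth (contDiffAt_conformal_comp H hu hx))
    (H.differentiableAt_normal hx) w

theorem differentiableAt_covField_map (w : F) :
    DifferentiableAt ℝ (fun x => covField G u (φ x) (fderiv ℝ φ x w)) x :=
  ((differentiableAt_of_smooth (hu.contDiffAt_covField H.metric (H.mem x hx))).comp x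
    (H.differentiableAt_map hx)).clm_apply (H.differentiableAt_fderiv_map_apply hx w)

theorem covAlong_covField (v w : F) :
    covAlong G φ (fun x => covField G u (φ x) (fderiv ℝ φ x w)) x v =
      covField₂ G u (φ x) (fderiv ℝ φ x v) (fderiv ℝ φ x w)
        + covField G u (φ x) (covAlong G φ (fun x => fderiv ℝ φ x w) x v) := by
  have hB := differentiableAt_of_smooth (hu.contDiffAt_covField H.metric (H.mem x hx))
  have hφ := H.differentiableAt_map hx
  have hBφ : DifferentiableAt ℝ (fun x => covField G u (φ x)) x := hB.comp x hφ
  rw [covField₂, covAlong_apply, covAlong_apply, covAlong_apply,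
    fderiv_apply_apply hBφ (H.differentiableAt_fderiv_map_apply hx w),
    fderiv_comp_fun_apply hB hφ, fderiv_apply_const hB, map_add]
  simp only [fderiv_fun_id, ContinuousLinearMap.id_apply]
  abel

theorem fderiv_fderiv_supportFunction (v w : F) :
    fderiv ℝ (fderiv ℝ (supportFunction G φ ν u)) x v w =
      G (φ x) (covField₂ G u (φ x) (fderiv ℝ φ x v) (fderiv ℝ φ x w)) (ν x)
      + G (φ x) (covField G u (φ x) (covAlong G φ (fun x => fderiv ℝ φ x w) x v)) (ν x)
      + G (φ x) (covField G u (φ x) (fderiv ℝ φ x w)) (covAlong G φ ν x v)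
      + G (φ x) (covField G u (φ x) (fderiv ℝ φ x v)) (covAlong G φ ν x w)
      + G (φ x) (u (φ x)) (covAlong G φ (fun x => covAlong G φ ν x w) x v) := by
  have hd := differentiableAt_of_smooth (contDiffAt_conformal_comp H hu hx)
  rw [← fderiv_apply_const (differentiableAt_of_smooth
    (contDiffAt_fderiv (contDiffAt_supportFunction H hu hx))) w v]
  have h1 : (fun x => fderiv ℝ (supportFunction G φ ν u) x w) =ᶠ[nhds x]
      fun x => G (φ x) (covField G u (φ x) (fderiv ℝ φ x w)) (ν x)
        + G (φ x) (u (φ x)) (covAlong G φ ν x w) := by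
    filter_upwards [H.isOpen.mem_nhds hx] with y hy using fderiv_supportFunction H hu hy w
  rw [h1.fderiv_eq, fderiv_fun_add
    (H.metric.differentiableAt_metric (H.mem x hx) (H.differentiableAt_map hx)
      (differentiableAt_covField_map H hu hx w) (H.differentiableAt_normal hx))
    (H.metric.differentiableAt_metric (H.mem x hx) (H.differentiableAt_map hx)
      hd (H.differentiableAt_covAlong_normal hx w)), _root_.add_apply,
    H.fderiv_metric hx (differentiableAt_covField_map H hu hx w) (H.differentiableAt_normal hx),
    H.fderiv_metric hx hd (H.differentiableAt_covAlong_normal hx w),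
    covAlong_covField H hu hx, covAlong_conformal H hu hx, map_add, _root_.add_apply]
  ring

/-- The Hessian of the support function of a conformal field:
`Hess f = -∇_z A - f A² - ν(κ) I - f R(·, ν)ν - κ A + [β, A]`, with `z` and `β` the tangential
parts of `u` and `∇u`. -/
theorem coordHess_supportFunction (v : F) :
    coordHess G φ (supportFunction G φ ν u) x v =
      -covShape G φ ν x (tanPart G φ x (u (φ x))) v
      - supportFunction G φ ν u x • coordShape G φ ν x (coordShape G φ ν x v)
      - fderiv ℝ κ (φ x) (ν x) • v
      - supportFunction G φ ν u x •
        tanPart G φ x (coordCurvature G (φ x) (ν x) (ν x) (fderiv ℝ φ x v))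
      - κ (φ x) • coordShape G φ ν x v
      + (tanPart G φ x (covField G u (φ x) (fderiv ℝ φ x (coordShape G φ ν x v)))
        - coordShape G φ ν x (tanPart G φ x (covField G u (φ x) (fderiv ℝ φ x v)))) := by
  refine H.ext_left hx fun w => ?_
  have hy := H.mem x hx
  set z := tanPart G φ x (u (φ x)) with hz
  have hdec : u (φ x) = fderiv ℝ φ x z + supportFunction G φ ν u x • ν x := H.decomp hx _
  rw [H.pullMetric_coordHess hx (contDiffAt_supportFunction H hu hx),
    fderiv_fderiv_supportFunction H hu hx,
    fderiv_supportFunction H hu hx, H.covAlong_fderiv hx v w, map_add (covField G u (φ x)),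
    map_smul (covField G u (φ x)), H.covAlong_normal hx v, H.covAlong_normal hx w]
  simp only [map_add, map_sub, map_neg, map_smul, _root_.add_apply, _root_.sub_apply,
    _root_.neg_apply, _root_.smul_apply, smul_eq_mul, H.pullMetric_tanPart hx]
  -- the normal component of `∇u`
  have e1 := hu.covField_add H.metric hy (ν x) (ν x)
  rw [H.unit x hx, H.metric_symm hx (ν x)] at e1
  -- the tangential components of `∇u`
  have e2 := hu.covField_add H.metric hy (fderiv ℝ φ x (coordShape G φ ν x v)) (fderiv ℝ φ x w)
  rw [← pullMetric_apply, H.metric_symm hx (fderiv ℝ φ x (coordShape G φ ν x v))] at e2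
  have e3 : pullMetric G φ x
      (coordShape G φ ν x (tanPart G φ x (covField G u (φ x) (fderiv ℝ φ x v)))) w =
      G (φ x) (covField G u (φ x) (fderiv ℝ φ x v)) (fderiv ℝ φ x (coordShape G φ ν x w)) := by
    rw [H.coordShape_symm hx, H.pullMetric_tanPart hx]
  -- the second covariant derivatives of `ν`
  have e4 : G (φ x) (u (φ x)) (covAlong G φ (fun x => covAlong G φ ν x w) x v)
      - G (φ x) (u (φ x)) (covAlong G φ ν x (inducedChristoffel G φ x v w)) =
      -pullMetric G φ x (covShape G φ ν x v w) z
        - supportFunction G φ ν u x *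
          pullMetric G φ x (coordShape G φ ν x (coordShape G φ ν x v)) w := by
    rw [← map_sub]
    change G (φ x) (u (φ x)) (normalSecond G φ ν x v w) = _
    rw [H.metric_symm hx, hdec, map_add, map_smul, H.metric_normalSecond_tangent hx,
      H.metric_normalSecond_normal hx, H.coordShape_symm hx (coordShape G φ ν x v), smul_eq_mul]
    ring
  have e5 := H.pullMetric_covShape_symm hx v w z
  have e6 := H.pullMetric_covShape_sub hx v z w
  -- the second covariant derivative of `u`
  have e7 := hu.covField₂_eq H.metric hy (fderiv ℝ φ x v) (fderiv ℝ φ x w) (ν x)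
  rw [H.metric_symm hx (fderiv ℝ φ x w), H.normal x hx, H.normal x hx, ← pullMetric_apply, hdec,
    map_add,
    map_smul, H.metric.curvature_pair_symm hy (ν x) _ _ (fderiv ℝ φ x z),
    H.metric.curvature_pair_symm hy (ν x) _ _ (ν x), smul_eq_mul] at e7
  have e8 : G (φ x) (covField G u (φ x) (ν x)) (ν x) = κ (φ x) := by linarith
  rw [e8]
  linarith

end Support

end LocalFormula

/-! ### The trace formula in coordinates -/

section LocalTrace

variable {E : Type*} [NormedAddCommGroup E] [NormedSpace ℝ E] [FiniteDimensional ℝ E]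
  {F : Type*} [NormedAddCommGroup F] [NormedSpace ℝ F] [FiniteDimensional ℝ F]
  {G : E → E →L[ℝ] E →L[ℝ] ℝ} {V : Set E} {φ ν : F → E} {O : Set F} {x : F}
  {u : E → E} {κ : E → ℝ}

theorem trace_mul_commutator {T a : Module.End ℝ F} (h : a * T = T * a) (B : Module.End ℝ F) :
    LinearMap.trace ℝ F (T * (B * a - a * B)) = 0 := by
  rw [mul_sub, map_sub, ← mul_assoc, LinearMap.trace_mul_comm, ← mul_assoc, ← mul_assoc, h,
    sub_self]

/-- The normal curvature operator `v ↦ (R(∂_v φ, ν) ν)^⊤` in coordinates. -/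
noncomputable def coordNormalCurvature (G : E → E →L[ℝ] E →L[ℝ] ℝ) (φ ν : F → E) (x : F) :
    F →L[ℝ] F :=
  (tanPart G φ x).comp ((coordCurvature G (φ x) (ν x) (ν x)).comp (fderiv ℝ φ x))

/-- The formula for `L_r` of the support function, in coordinates. The commutators in
`coordHess_supportFunction` and in `∇_z A = ∂_z A + [Ξ_z, A]` are trace-free against `T_r`. -/
theorem trace_newton_coordHess_supportFunction (H : IsHypersurfaceOn G V φ ν O)
    (hu : IsConformalOn G u κ V) (hx : x ∈ O) (r : ℕ) {T a : Module.End ℝ F}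
    (ha : a = (coordShape G φ ν x : F →ₗ[ℝ] F)) (hT : T = endNewton a r) :
    LinearMap.trace ℝ F (T * (coordHess G φ (supportFunction G φ ν u) x : F →ₗ[ℝ] F)) =
      -fderiv ℝ (fun y => endSymm (coordShape G φ ν y : F →ₗ[ℝ] F) (r + 1)) x
          (tanPart G φ x (u (φ x)))
      - supportFunction G φ ν u x * LinearMap.trace ℝ F (a * (a * T))
      - supportFunction G φ ν u x *
        LinearMap.trace ℝ F ((coordNormalCurvature G φ ν x : F →ₗ[ℝ] F) * T)
      - κ (φ x) * LinearMap.trace ℝ F (a * T)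
      - fderiv ℝ κ (φ x) (ν x) * LinearMap.trace ℝ F T := by
  set z := tanPart G φ x (u (φ x)) with hz
  set A' : Module.End ℝ F := (fderiv ℝ (coordShape G φ ν) x z : F →ₗ[ℝ] F) with hA'
  set R : Module.End ℝ F := (coordNormalCurvature G φ ν x : F →ₗ[ℝ] F) with hR
  let Ξ : Module.End ℝ F :=
    { toFun := inducedChristoffel G φ x z
      map_add' := H.inducedChristoffel_add hx z
      map_smul' := fun c w => H.inducedChristoffel_smul hx z w c }
  let β : Module.End ℝ F :=
    ((tanPart G φ x).comp ((covField G u (φ x)).comp (fderiv ℝ φ x)) : F →ₗ[ℝ] F)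
  have hcomm : a * T = T * a := hT ▸ endNewton_comm a r
  have hH : (coordHess G φ (supportFunction G φ ν u) x : F →ₗ[ℝ] F) =
      -(A' + (Ξ * a - a * Ξ)) - supportFunction G φ ν u x • (a * a) - fderiv ℝ κ (φ x) (ν x) • 1
        - supportFunction G φ ν u x • R - κ (φ x) • a + (β * a - a * β) := by
    ext v
    subst ha
    refine (coordHess_supportFunction H hu hx v).trans ?_
    rw [covShape, add_sub_assoc]
    rfl
  have hS := (hasFDerivAt_endSymm (differentiableAt_of_smooth (H.contDiffAt_coordShape hx)) r).2 z
  rw [← ha, ← hT] at hS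
  change _ = LinearMap.trace ℝ F (T * A') at hS
  have h1 : LinearMap.trace ℝ F (T * (a * a)) = LinearMap.trace ℝ F (a * (a * T)) := by
    rw [LinearMap.trace_mul_comm, mul_assoc]
  rw [hH, hS]
  simp only [mul_add, mul_sub T, mul_neg, mul_smul_comm, mul_one, map_add, map_sub, map_neg,
    map_smul, smul_eq_mul]
  rw [h1, LinearMap.trace_mul_comm ℝ T a, LinearMap.trace_mul_comm ℝ T R]
  have h2 := trace_mul_commutator hcomm Ξ
  have h3 := trace_mul_commutator hcomm β
  rw [mul_sub, map_sub] at h2 h3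
  linarith

end LocalTrace

/-! ### Change of coordinates -/

section CoordinateChange

variable {E : Type*} [NormedAddCommGroup E] [NormedSpace ℝ E] [FiniteDimensional ℝ E]
  {F : Type*} [NormedAddCommGroup F] [NormedSpace ℝ F]
  {G G' : E → E →L[ℝ] E →L[ℝ] ℝ} {V V' : Set E} {τ : E → E} {y : E}

/-- `τ` is, near `y`, a change of coordinates under which the metric `G` becomes `G'`. -/
structure IsCoordChangeAt (G G' : E → E →L[ℝ] E →L[ℝ] ℝ) (τ : E → E) (y : E) : Prop where
  contDiffAt : ContDiffAt ℝ ∞ τ y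
  surjective : Function.Surjective (fderiv ℝ τ y)
  pullback : ∀ᶠ z in nhds y, ∀ a b, G' z a b = G (τ z) (fderiv ℝ τ z a) (fderiv ℝ τ z b)

namespace IsCoordChangeAt

variable (hτ : IsCoordChangeAt G G' τ y) (hG : IsMetricOn G V) (hG' : IsMetricOn G' V')
  (hy : y ∈ V') (hτy : τ y ∈ V)
include hτ hG hG' hy hτy

theorem fderiv_metric (a b c : E) :
    fderiv ℝ G' y c a b = fderiv ℝ G (τ y) (fderiv ℝ τ y c) (fderiv ℝ τ y a) (fderiv ℝ τ y b)
      + G (τ y) (fderiv ℝ (fderiv ℝ τ) y c a) (fderiv ℝ τ y b)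
      + G (τ y) (fderiv ℝ τ y a) (fderiv ℝ (fderiv ℝ τ) y c b) := by
  have hτd := differentiableAt_of_smooth hτ.contDiffAt
  have hτ' := differentiableAt_of_smooth (contDiffAt_fderiv hτ.contDiffAt)
  have hGd := hG.differentiableAt hτy
  have hGτ : DifferentiableAt ℝ (fun z => G (τ z)) y := hGd.comp y hτd
  have hGd' := hG'.differentiableAt hy
  have h1 : (fun z => G' z a b) =ᶠ[nhds y]
      fun z => G (τ z) (fderiv ℝ τ z a) (fderiv ℝ τ z b) := by
    filter_upwards [hτ.pullback] with z hz using hz a b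
  have hτa : ∀ a, DifferentiableAt ℝ (fun z => fderiv ℝ τ z a) y :=
    fun a => hτ'.clm_apply (differentiableAt_const a)
  rw [← fderiv_apply_const hGd', ← fderiv_apply_const
      (f := fun z => G' z a) (hGd'.clm_apply (differentiableAt_const a)), h1.fderiv_eq,
    fderiv_apply_apply (f := fun z => G (τ z) (fderiv ℝ τ z a)) (hGτ.clm_apply (hτa a)) (hτa b),
    fderiv_apply_apply hGτ (hτa a), fderiv_comp_fun_apply hGd hτd, fderiv_apply_const hτ',
    fderiv_apply_const hτ', _root_.add_apply]

/-- The transformation law of the Christoffel symbols. -/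
theorem fderiv_christoffel (a b : E) :
    fderiv ℝ τ y (christoffel G' y a b) = fderiv ℝ (fderiv ℝ τ) y a b
      + christoffel G (τ y) (fderiv ℝ τ y a) (fderiv ℝ τ y b) := by
  refine hG.ext_left hτy fun c => ?_
  obtain ⟨c, rfl⟩ := hτ.surjective c
  rw [← hτ.pullback.self_of_nhds, hG'.metric_christoffel hy, map_add, _root_.add_apply,
    hG.metric_christoffel hτy, christoffelFirst_apply, christoffelFirst_apply]
  simp only [hτ.fderiv_metric hG hG' hy hτy]
  rw [fderiv_fderiv_symm hτ.contDiffAt b a, fderiv_fderiv_symm hτ.contDiffAt c a,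
    fderiv_fderiv_symm hτ.contDiffAt c b,
    hG.symm _ hτy (fderiv ℝ τ y b) (fderiv ℝ (fderiv ℝ τ) y a c),
    hG.symm _ hτy (fderiv ℝ τ y a) (fderiv ℝ (fderiv ℝ τ) y b c)]
  ring

end IsCoordChangeAt

/-- Covariant derivatives along a map do not depend on the coordinates. -/
theorem IsCoordChangeAt.covAlong {φ φ' W W' : F → E} {x : F} (hG : IsMetricOn G V)
    (hG' : IsMetricOn G' V') (hτ : IsCoordChangeAt G G' τ (φ' x)) (hx : φ' x ∈ V')
    (hτx : τ (φ' x) ∈ V) (hφ' : DifferentiableAt ℝ φ' x) (hW' : DifferentiableAt ℝ W' x)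
    (hφ : ∀ᶠ z in nhds x, φ z = τ (φ' z)) (hW : ∀ᶠ z in nhds x, W z = fderiv ℝ τ (φ' z) (W' z))
    (v : F) : covAlong G φ W x v = fderiv ℝ τ (φ' x) (covAlong G' φ' W' x v) := by
  have hτd := differentiableAt_of_smooth hτ.contDiffAt
  have hτ' := differentiableAt_of_smooth (contDiffAt_fderiv hτ.contDiffAt)
  have hτφ : DifferentiableAt ℝ (fun z => fderiv ℝ τ (φ' z)) x := hτ'.comp x hφ'
  rw [covAlong_apply, covAlong_apply, Filter.EventuallyEq.fderiv_eq hφ,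
    Filter.EventuallyEq.fderiv_eq hW, hφ.self_of_nhds, hW.self_of_nhds,
    fderiv_comp_fun_apply hτd hφ', fderiv_apply_apply hτφ hW', fderiv_comp_fun_apply hτ' hφ',
    map_add,
    hτ.fderiv_christoffel hG hG' hx hτx]
  abel

/-- The Lie derivative of the metric does not depend on the coordinates. -/
theorem IsCoordChangeAt.coordLieDerivMetric {u u' : E → E} (hG : IsMetricOn G V)
    (hG' : IsMetricOn G' V') (hτ : IsCoordChangeAt G G' τ y) (hy : y ∈ V')
    (hτy : τ y ∈ V) (hu : DifferentiableAt ℝ u (τ y)) (hu' : DifferentiableAt ℝ u' y)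
    (h : ∀ᶠ z in nhds y, u (τ z) = fderiv ℝ τ z (u' z)) (a b : E) :
    coordLieDerivMetric G u (τ y) (fderiv ℝ τ y a) (fderiv ℝ τ y b) =
      coordLieDerivMetric G' u' y a b := by
  have key : ∀ a, covField G u (τ y) (fderiv ℝ τ y a) = fderiv ℝ τ y (covField G' u' y a) := by
    intro a
    have h1 := IsCoordChangeAt.covAlong (φ := τ) (φ' := fun z => z) (W := fun z => u (τ z)) hG hG'
      hτ hy hτy differentiableAt_id hu' (Filter.Eventually.of_forall fun z => rfl) h a
    rw [covField, covField, ← h1, covAlong_apply, covAlong_apply,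
      fderiv_comp_fun_apply hu (differentiableAt_of_smooth hτ.contDiffAt)]
    simp
  rw [hG.coordLieDerivMetric_eq hτy, hG'.coordLieDerivMetric_eq hy, key, key,
    ← hτ.pullback.self_of_nhds, ← hτ.pullback.self_of_nhds]

end CoordinateChange

/-! ### Calculus in the charts of a manifold -/

section Charts

variable {E : Type*} [NormedAddCommGroup E] [NormedSpace ℝ E]
  {M : Type*} [TopologicalSpace M] [ChartedSpace E M]

/-- A function on a manifold, read in the preferred chart around `c`. -/
noncomputable def inChart {X : Type*} (c : M) (h : M → X) (y : E) : X :=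
  h ((extChartAt 𝓘(ℝ, E) c).symm y)

theorem inChart_apply {X : Type*} {c x : M} (hx : x ∈ (extChartAt 𝓘(ℝ, E) c).source) (h : M → X) :
    inChart c h (extChartAt 𝓘(ℝ, E) c x) = h x := by
  rw [inChart, (extChartAt 𝓘(ℝ, E) c).left_inv hx]

theorem exists_chart_symm {c x : M} (hx : x ∈ (extChartAt 𝓘(ℝ, E) c).source) :
    ∃ y ∈ (extChartAt 𝓘(ℝ, E) c).target, (extChartAt 𝓘(ℝ, E) c).symm y = x :=
  ⟨_, (extChartAt 𝓘(ℝ, E) c).map_source hx, (extChartAt 𝓘(ℝ, E) c).left_inv hx⟩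

variable [IsManifold 𝓘(ℝ, E) ∞ M]

theorem isManifold_one : IsManifold 𝓘(ℝ, E) 1 M :=
  IsManifold.of_le (n := ∞) (by exact_mod_cast le_top)

theorem mdifferentiableAt_chart {c x : M} (hx : x ∈ (extChartAt 𝓘(ℝ, E) c).source) :
    MDifferentiableAt 𝓘(ℝ, E) 𝓘(ℝ, E) (extChartAt 𝓘(ℝ, E) c) x := by
  have := isManifold_one (E := E) (M := M)
  exact mdifferentiableAt_extChartAt (by rwa [extChartAt_source] at hx)

theorem isInvertible_chartDiff {c x : M} (hx : x ∈ (extChartAt 𝓘(ℝ, E) c).source) :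
    (chartDiff (E := E) c x).IsInvertible := by
  have := isManifold_one (E := E) (M := M)
  exact isInvertible_mfderiv_extChartAt hx

theorem chartDiff_comp_chartSymmDiff {c : M} {y : E} (hy : y ∈ (extChartAt 𝓘(ℝ, E) c).target)
    (a : E) : chartDiff c ((extChartAt 𝓘(ℝ, E) c).symm y) (chartSymmDiff c y a) = a := by
  have := isManifold_one (E := E) (M := M)
  have h := mfderiv_extChartAt_comp_mfderivWithin_extChartAt_symm (I := 𝓘(ℝ, E)) hy
  rw [ModelWithCorners.range_eq_univ, mfderivWithin_univ] at h
  exact congrArg (fun l : E →L[ℝ] E => l a) h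

theorem chartSymmDiff_comp_chartDiff {c : M} {y : E} (hy : y ∈ (extChartAt 𝓘(ℝ, E) c).target)
    (a : TangentSpace 𝓘(ℝ, E) ((extChartAt 𝓘(ℝ, E) c).symm y)) :
    chartSymmDiff c y (chartDiff c ((extChartAt 𝓘(ℝ, E) c).symm y) a) = a := by
  have := isManifold_one (E := E) (M := M)
  have h := mfderivWithin_extChartAt_symm_comp_mfderiv_extChartAt (I := 𝓘(ℝ, E)) hy
  rw [ModelWithCorners.range_eq_univ, mfderivWithin_univ] at h
  exact congrArg (fun l : E →L[ℝ] E => l a) h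

theorem chartDiff_fromCoord (x : M) (a : E) : chartDiff x x (fromCoord x a) = a :=
  (isInvertible_chartDiff (mem_extChartAt_source x)).self_apply_inverse a

/-- The differential of a function in a chart. -/
theorem mfderiv_eq_fderiv_inChart {X : Type*} [NormedAddCommGroup X] [NormedSpace ℝ X]
    {h : M → X} {c x : M} (hx : x ∈ (extChartAt 𝓘(ℝ, E) c).source)
    (hh : DifferentiableAt ℝ (inChart c h) (extChartAt 𝓘(ℝ, E) c x))
    (v : TangentSpace 𝓘(ℝ, E) x) :
    mfderiv 𝓘(ℝ, E) 𝓘(ℝ, X) h x v =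
      fderiv ℝ (inChart c h) (extChartAt 𝓘(ℝ, E) c x) (chartDiff c x v) := by
  have h1 : h =ᶠ[nhds x] inChart c h ∘ extChartAt 𝓘(ℝ, E) c := by
    filter_upwards [extChartAt_source_mem_nhds' (I := 𝓘(ℝ, E)) hx] with z hz
    exact (inChart_apply hz h).symm
  rw [h1.mfderiv_eq, mfderiv_comp x hh.mdifferentiableAt (mdifferentiableAt_chart hx),
    mfderiv_eq_fderiv]
  rfl

theorem contDiffAt_inChart {X : Type*} [NormedAddCommGroup X] [NormedSpace ℝ X]
    {h : M → X} {c x : M} (hx : x ∈ (extChartAt 𝓘(ℝ, E) c).source)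
    (hh : ContMDiffAt 𝓘(ℝ, E) 𝓘(ℝ, X) ∞ h x) :
    ContDiffAt ℝ ∞ (inChart c h) (extChartAt 𝓘(ℝ, E) c x) := by
  have h1 : ContMDiffAt 𝓘(ℝ, E) 𝓘(ℝ, E) ∞ (extChartAt 𝓘(ℝ, E) c).symm
      (extChartAt 𝓘(ℝ, E) c x) :=
    (contMDiffOn_extChartAt_symm (I := 𝓘(ℝ, E)) (n := ∞) c).contMDiffAt
      ((isOpen_extChartAt_target c).mem_nhds ((extChartAt 𝓘(ℝ, E) c).map_source hx))
  have h2 : ContMDiffAt 𝓘(ℝ, E) 𝓘(ℝ, X) ∞ (inChart c h) (extChartAt 𝓘(ℝ, E) c x) := by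
    refine ContMDiffAt.comp (extChartAt 𝓘(ℝ, E) c x) ?_ h1
    rwa [(extChartAt 𝓘(ℝ, E) c).left_inv hx]
  exact h2.contDiffAt

/-- Smoothness of a vector field along a map, in terms of its coordinates. -/
theorem contMDiffAt_along_iff {F : Type*} [NormedAddCommGroup F] [NormedSpace ℝ F]
    {L : Type*} [TopologicalSpace L] [ChartedSpace F L]
    {b : L → M} {W : ∀ q, TangentSpace 𝓘(ℝ, E) (b q)} {q : L} {c : M}
    (hq : b q ∈ (extChartAt 𝓘(ℝ, E) c).source) :
    ContMDiffAt 𝓘(ℝ, F) 𝓘(ℝ, E).tangent ∞ (fun q => (⟨b q, W q⟩ : TangentBundle 𝓘(ℝ, E) M)) q ↔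
      ContMDiffAt 𝓘(ℝ, F) 𝓘(ℝ, E) ∞ b q ∧
      ContMDiffAt 𝓘(ℝ, F) 𝓘(ℝ, E) ∞ (fun q => chartDiff (E := E) c (b q) (W q)) q := by
  have := isManifold_one (E := E) (M := M)
  rw [extChartAt_source] at hq
  set e := trivializationAt E (TangentSpace 𝓘(ℝ, E)) c with he
  rw [e.contMDiffAt_iff (by rw [e.mem_source]; exact hq)]
  refine and_congr_right fun hb => ?_
  refine Filter.EventuallyEq.contMDiffAt_iff ?_
  filter_upwards [hb.continuousAt.preimage_mem_nhds ((chartAt E c).open_source.mem_nhds hq)]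
    with z hz
  rw [chartDiff, ← TangentBundle.continuousLinearMapAt_trivializationAt hz]
  exact (congrFun (e.coe_linearMapAt_of_mem (R := ℝ) hz) (W z)).symm

/-- The chart map around `c`, read in the chart around `c'`, relates the coordinates of tangent
vectors. -/
theorem fderiv_coordChange {c c' x : M} (hc : x ∈ (extChartAt 𝓘(ℝ, E) c).source)
    (hc' : x ∈ (extChartAt 𝓘(ℝ, E) c').source) (a : TangentSpace 𝓘(ℝ, E) x) :
    fderiv ℝ (inChart c' (extChartAt 𝓘(ℝ, E) c)) (extChartAt 𝓘(ℝ, E) c' x) (chartDiff c' x a) =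
      chartDiff (E := E) c x a := by
  rw [← mfderiv_eq_fderiv_inChart hc' (differentiableAt_of_smooth (contDiffAt_inChart hc'
    (contMDiffAt_extChartAt' (by rwa [extChartAt_source] at hc))))]
  rfl

theorem eventually_chart_symm_mem {c x : M} (hx : x ∈ (extChartAt 𝓘(ℝ, E) c).source) {s : Set M}
    (hs : s ∈ nhds x) : ∀ᶠ y in nhds (extChartAt 𝓘(ℝ, E) c x),
      y ∈ (extChartAt 𝓘(ℝ, E) c).target ∧ (extChartAt 𝓘(ℝ, E) c).symm y ∈ s := by
  refine Filter.Eventually.and ((isOpen_extChartAt_target c).mem_nhds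
    ((extChartAt 𝓘(ℝ, E) c).map_source hx)) ?_
  refine (continuousAt_extChartAt_symm' hx).preimage_mem_nhds ?_
  rwa [(extChartAt 𝓘(ℝ, E) c).left_inv hx]

variable
  (g : ContMDiffRiemannianMetric 𝓘(ℝ, E) ∞ E (fun x : M => TangentSpace 𝓘(ℝ, E) x))

theorem chartMetric_apply (c : M) (y a b : E) : chartMetric g c y a b =
    g.inner ((extChartAt 𝓘(ℝ, E) c).symm y) (chartSymmDiff c y a) (chartSymmDiff c y b) :=
  rfl

theorem chartMetric_chartDiff {c x : M} (hx : x ∈ (extChartAt 𝓘(ℝ, E) c).source)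
    (a b : TangentSpace 𝓘(ℝ, E) x) :
    chartMetric g c (extChartAt 𝓘(ℝ, E) c x) (chartDiff c x a) (chartDiff c x b) =
      g.inner x a b := by
  obtain ⟨y, hy, rfl⟩ := exists_chart_symm hx
  rw [(extChartAt 𝓘(ℝ, E) c).right_inv hy, chartMetric_apply, chartSymmDiff_comp_chartDiff hy,
    chartSymmDiff_comp_chartDiff hy]

theorem contMDiffAt_chartSymmDiff {c : M} {y : E} (hy : y ∈ (extChartAt 𝓘(ℝ, E) c).target) (a : E) :
    ContMDiffAt 𝓘(ℝ, E) 𝓘(ℝ, E).tangent ∞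
      (fun y => (⟨(extChartAt 𝓘(ℝ, E) c).symm y, chartSymmDiff c y a⟩ :
        TangentBundle 𝓘(ℝ, E) M)) y := by
  have ht := (isOpen_extChartAt_target (I := 𝓘(ℝ, E)) c).mem_nhds hy
  rw [contMDiffAt_along_iff (c := c) ((extChartAt 𝓘(ℝ, E) c).map_target hy)]
  refine ⟨(contMDiffOn_extChartAt_symm (I := 𝓘(ℝ, E)) (n := ∞) c).contMDiffAt ht, ?_⟩
  refine (contMDiffAt_const (c := a)).congr_of_eventuallyEq ?_
  filter_upwards [ht] with z hz using chartDiff_comp_chartSymmDiff hz a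

theorem isMetricOn_chartMetric [FiniteDimensional ℝ E] (c : M) :
    IsMetricOn (chartMetric g c) (extChartAt 𝓘(ℝ, E) c).target where
  isOpen := isOpen_extChartAt_target c
  contDiffOn := by
    refine contDiffOn_clm_apply.mpr fun a => contDiffOn_clm_apply.mpr fun b y hy => ?_
    have hb : ContMDiffAt 𝓘(ℝ, E) 𝓘(ℝ, E) ∞ (extChartAt 𝓘(ℝ, E) c).symm y :=
      (contMDiffOn_extChartAt_symm (I := 𝓘(ℝ, E)) (n := ∞) c).contMDiffAt
        ((isOpen_extChartAt_target (I := 𝓘(ℝ, E)) c).mem_nhds hy)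
    have h1 := ContMDiffAt.clm_bundle_apply₂ (F₁ := E) (F₂ := E) (F₃ := ℝ)
      (E₁ := fun x : M => TangentSpace 𝓘(ℝ, E) x) (E₂ := fun x : M => TangentSpace 𝓘(ℝ, E) x)
      (E₃ := Bundle.Trivial M ℝ) (b := (extChartAt 𝓘(ℝ, E) c).symm)
      (ψ := fun y => g.inner ((extChartAt 𝓘(ℝ, E) c).symm y))
      (g.contMDiff.contMDiffAt.comp y hb)
      (contMDiffAt_chartSymmDiff hy a) (contMDiffAt_chartSymmDiff hy b)
    have h2 := (Bundle.contMDiffAt_totalSpace.mp h1).2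
    exact h2.contDiffAt.contDiffWithinAt
  symm y _ a b := g.symm _ _ _
  pos y hy a ha := by
    refine g.pos _ _ fun h => ha ?_
    have h1 := chartDiff_comp_chartSymmDiff hy a
    exact h1.symm.trans ((congrArg (chartDiff c _) h).trans (map_zero (chartDiff c _)))

theorem isCoordChangeAt_chart {c c' x : M} (hc : x ∈ (extChartAt 𝓘(ℝ, E) c).source)
    (hc' : x ∈ (extChartAt 𝓘(ℝ, E) c').source) :
    IsCoordChangeAt (chartMetric g c) (chartMetric g c') (inChart c' (extChartAt 𝓘(ℝ, E) c))
      (extChartAt 𝓘(ℝ, E) c' x) where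
  contDiffAt := contDiffAt_inChart hc'
    (contMDiffAt_extChartAt' (by rwa [extChartAt_source] at hc))
  surjective a := by
    obtain ⟨b, rfl⟩ := (isInvertible_chartDiff hc).surjective a
    exact ⟨_, fderiv_coordChange hc hc' b⟩
  pullback := by
    filter_upwards [eventually_chart_symm_mem hc' (extChartAt_source_mem_nhds' hc)]
      with z ⟨hz, hzc⟩ a b
    obtain ⟨x', hx', rfl⟩ : ∃ x' ∈ (extChartAt 𝓘(ℝ, E) c').source, extChartAt 𝓘(ℝ, E) c' x' = z :=
      ⟨_, (extChartAt 𝓘(ℝ, E) c').map_target hz, (extChartAt 𝓘(ℝ, E) c').right_inv hz⟩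
    rw [(extChartAt 𝓘(ℝ, E) c').left_inv hx'] at hzc
    obtain ⟨a, rfl⟩ := (isInvertible_chartDiff hx').surjective a
    obtain ⟨b, rfl⟩ := (isInvertible_chartDiff hx').surjective b
    rw [fderiv_coordChange hzc hx', fderiv_coordChange hzc hx', chartMetric_chartDiff g hx',
      inChart_apply hx', chartMetric_chartDiff g hzc]

theorem chartField_apply {c x : M} (hx : x ∈ (extChartAt 𝓘(ℝ, E) c).source)
    (U : ∀ x : M, TangentSpace 𝓘(ℝ, E) x) :
    chartField U c (extChartAt 𝓘(ℝ, E) c x) = chartDiff c x (U x) :=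
  inChart_apply hx fun x => chartDiff (E := E) c x (U x)

theorem contDiffAt_chartField {c x : M} (hx : x ∈ (extChartAt 𝓘(ℝ, E) c).source)
    {U : ∀ x : M, TangentSpace 𝓘(ℝ, E) x} (hU : ContMDiff 𝓘(ℝ, E) 𝓘(ℝ, E).tangent ∞
      (fun x => (⟨x, U x⟩ : TangentBundle 𝓘(ℝ, E) M))) :
    ContDiffAt ℝ ∞ (chartField U c) (extChartAt 𝓘(ℝ, E) c x) :=
  contDiffAt_inChart hx ((contMDiffAt_along_iff (b := fun x : M => x) hx).mp hU.contMDiffAt).2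

/-- A conformal field is conformal in every chart, at every point of the chart. -/
theorem IsConformalField.isConformalOn [FiniteDimensional ℝ E]
    {g : ContMDiffRiemannianMetric 𝓘(ℝ, E) ∞ E (fun x : M => TangentSpace 𝓘(ℝ, E) x)}
    {U : ∀ x : M, TangentSpace 𝓘(ℝ, E) x} {k : M → ℝ} (hU : IsConformalField g U k) (c : M) :
    IsConformalOn (chartMetric g c) (chartField U c) (inChart c k)
      (extChartAt 𝓘(ℝ, E) c).target where
  contDiffAt_field y hy := by
    rw [← (extChartAt 𝓘(ℝ, E) c).right_inv hy]
    exact contDiffAt_chartField ((extChartAt 𝓘(ℝ, E) c).map_target hy) hU.contMDiff_field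
  contDiffAt_factor y hy := by
    rw [← (extChartAt 𝓘(ℝ, E) c).right_inv hy]
    exact contDiffAt_inChart ((extChartAt 𝓘(ℝ, E) c).map_target hy)
      hU.contMDiff_factor.contMDiffAt
  lieDeriv y hy a b := by
    obtain ⟨x, hx, rfl⟩ : ∃ x ∈ (extChartAt 𝓘(ℝ, E) c).source, extChartAt 𝓘(ℝ, E) c x = y :=
      ⟨_, (extChartAt 𝓘(ℝ, E) c).map_target hy, (extChartAt 𝓘(ℝ, E) c).right_inv hy⟩
    obtain ⟨a, rfl⟩ := (isInvertible_chartDiff hx).surjective a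
    obtain ⟨b, rfl⟩ := (isInvertible_chartDiff hx).surjective b
    have hxx := mem_extChartAt_source (I := 𝓘(ℝ, E)) x
    have hτx : inChart x (extChartAt 𝓘(ℝ, E) c) (extChartAt 𝓘(ℝ, E) x x) =
        extChartAt 𝓘(ℝ, E) c x := inChart_apply hxx _
    rw [chartMetric_chartDiff g hx, inChart_apply hx, ← hU.lieDeriv_metric x a b,
      ← IsCoordChangeAt.coordLieDerivMetric (isMetricOn_chartMetric g c)
        (isMetricOn_chartMetric g x) (isCoordChangeAt_chart g hx hxx)
        ((extChartAt 𝓘(ℝ, E) x).map_source hxx) (u := chartField U c) (by rwa [hτx])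
        (by rw [hτx]
            exact differentiableAt_of_smooth (contDiffAt_chartField hx hU.contMDiff_field))
        (differentiableAt_of_smooth (contDiffAt_chartField hxx hU.contMDiff_field)) ?_,
      fderiv_coordChange hx hxx, fderiv_coordChange hx hxx, hτx]
    filter_upwards [eventually_chart_symm_mem hxx (extChartAt_source_mem_nhds' hx)]
      with z ⟨hz, hzc⟩
    obtain ⟨x', hx', rfl⟩ : ∃ x' ∈ (extChartAt 𝓘(ℝ, E) x).source, extChartAt 𝓘(ℝ, E) x x' = z :=
      ⟨_, (extChartAt 𝓘(ℝ, E) x).map_target hz, (extChartAt 𝓘(ℝ, E) x).right_inv hz⟩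
    rw [(extChartAt 𝓘(ℝ, E) x).left_inv hx'] at hzc
    rw [chartField_apply hx', fderiv_coordChange hzc hx', inChart_apply hx',
      chartField_apply hzc]

end Charts

/-! ### Immersed hypersurfaces in charts -/

section HypersurfaceCharts

variable {E : Type*} [NormedAddCommGroup E] [NormedSpace ℝ E] [FiniteDimensional ℝ E]
  {F : Type*} [NormedAddCommGroup F] [NormedSpace ℝ F] [FiniteDimensional ℝ F]
  {M : Type*} [TopologicalSpace M] [ChartedSpace E M] [IsManifold 𝓘(ℝ, E) ∞ M]
  {L : Type*} [TopologicalSpace L] [ChartedSpace F L] [IsManifold 𝓘(ℝ, F) ∞ L]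
  {g : ContMDiffRiemannianMetric 𝓘(ℝ, E) ∞ E (fun x : M => TangentSpace 𝓘(ℝ, E) x)}
  {ι : L → M}

/-- The map `ι : L → M`, read in the preferred charts around `p` and `c`. -/
noncomputable def mapInCharts (ι : L → M) (p : L) (c : M) : F → E :=
  inChart p fun q => extChartAt 𝓘(ℝ, E) c (ι q)

/-- A vector field along `ι : L → M`, read in the preferred charts around `p` and `c`. -/
noncomputable def fieldInCharts (ι : L → M) (W : ∀ q : L, TangentSpace 𝓘(ℝ, E) (ι q)) (p : L)
    (c : M) : F → E :=
  inChart p fun q => chartDiff (E := E) c (ι q) (W q)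

variable {p q : L} {c : M}

theorem mapInCharts_apply (hq : q ∈ (extChartAt 𝓘(ℝ, F) p).source) :
    mapInCharts ι p c (extChartAt 𝓘(ℝ, F) p q) = extChartAt 𝓘(ℝ, E) c (ι q) :=
  inChart_apply hq _

theorem fieldInCharts_apply (hq : q ∈ (extChartAt 𝓘(ℝ, F) p).source)
    (W : ∀ q : L, TangentSpace 𝓘(ℝ, E) (ι q)) :
    fieldInCharts ι W p c (extChartAt 𝓘(ℝ, F) p q) = chartDiff (E := E) c (ι q) (W q) :=
  inChart_apply hq fun q => chartDiff (E := E) c (ι q) (W q)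

theorem contDiffAt_mapInCharts (hι : ContMDiff 𝓘(ℝ, F) 𝓘(ℝ, E) ∞ ι)
    (hq : q ∈ (extChartAt 𝓘(ℝ, F) p).source) (hc : ι q ∈ (extChartAt 𝓘(ℝ, E) c).source) :
    ContDiffAt ℝ ∞ (mapInCharts ι p c : F → E) (extChartAt 𝓘(ℝ, F) p q) := by
  refine contDiffAt_inChart hq ?_
  rw [extChartAt_source] at hc
  exact (contMDiffAt_extChartAt' hc).comp q hι.contMDiffAt

theorem contDiffAt_fieldInCharts {W : ∀ q : L, TangentSpace 𝓘(ℝ, E) (ι q)}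
    (hW : ContMDiff 𝓘(ℝ, F) 𝓘(ℝ, E).tangent ∞ (fun q => (⟨ι q, W q⟩ : TangentBundle 𝓘(ℝ, E) M)))
    (hq : q ∈ (extChartAt 𝓘(ℝ, F) p).source) (hc : ι q ∈ (extChartAt 𝓘(ℝ, E) c).source) :
    ContDiffAt ℝ ∞ (fieldInCharts ι W p c) (extChartAt 𝓘(ℝ, F) p q) :=
  contDiffAt_inChart hq ((contMDiffAt_along_iff hc).mp hW.contMDiffAt).2

theorem fderiv_mapInCharts (hι : ContMDiff 𝓘(ℝ, F) 𝓘(ℝ, E) ∞ ι)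
    (hq : q ∈ (extChartAt 𝓘(ℝ, F) p).source) (hc : ι q ∈ (extChartAt 𝓘(ℝ, E) c).source)
    (v : TangentSpace 𝓘(ℝ, F) q) :
    fderiv ℝ (mapInCharts (F := F) ι p c) (extChartAt 𝓘(ℝ, F) p q) (chartDiff p q v) =
      chartDiff (E := E) c (ι q) (mfderiv 𝓘(ℝ, F) 𝓘(ℝ, E) ι q v) := by
  have h1 := mfderiv_eq_fderiv_inChart (h := fun q => extChartAt 𝓘(ℝ, E) c (ι q)) hq
    (differentiableAt_of_smooth (contDiffAt_mapInCharts hι hq hc)) v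
  have h2 := mfderiv_comp q (mdifferentiableAt_chart hc)
    (hι.contMDiffAt.mdifferentiableAt (by simp))
  rw [mapInCharts, ← h1]
  exact congrArg (fun l : F →L[ℝ] E => l v) h2

/-- The covariant derivative along `ι` can be computed in any pair of charts. -/
theorem chartDiff_covDerivAlong (hι : ContMDiff 𝓘(ℝ, F) 𝓘(ℝ, E) ∞ ι)
    (hq : q ∈ (extChartAt 𝓘(ℝ, F) p).source) (hc : ι q ∈ (extChartAt 𝓘(ℝ, E) c).source)
    {W : ∀ q : L, TangentSpace 𝓘(ℝ, E) (ι q)}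
    (hW : DifferentiableAt ℝ (fieldInCharts (F := F) ι W p (ι q)) (extChartAt 𝓘(ℝ, F) p q))
    (v : TangentSpace 𝓘(ℝ, F) q) :
    chartDiff (E := E) c (ι q) (covDerivAlong F g ι W q v) =
      covAlong (chartMetric g c) (mapInCharts ι p c) (fieldInCharts ι W p c)
        (extChartAt 𝓘(ℝ, F) p q) (chartDiff p q v) := by
  have hcc := mem_extChartAt_source (I := 𝓘(ℝ, E)) (ι q)
  have hx := mapInCharts_apply (E := E) (ι := ι) (c := ι q) hq
  have h1 : covDerivAlong F g ι W q v = fromCoord (ι q)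
      (covAlong (chartMetric g (ι q)) (mapInCharts ι p (ι q)) (fieldInCharts ι W p (ι q))
        (extChartAt 𝓘(ℝ, F) p q) (chartDiff p q v)) := by
    rw [covAlong_apply, fderiv_mapInCharts hι hq hcc, hx, fieldInCharts_apply hq, fieldInCharts,
      ← mfderiv_eq_fderiv_inChart hq hW]
    rfl
  have hev : ∀ᶠ z in nhds (extChartAt 𝓘(ℝ, F) p q), ∃ q' ∈ (extChartAt 𝓘(ℝ, F) p).source,
      extChartAt 𝓘(ℝ, F) p q' = z ∧ ι q' ∈ (extChartAt 𝓘(ℝ, E) c).source ∧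
        ι q' ∈ (extChartAt 𝓘(ℝ, E) (ι q)).source := by
    have hn := hι.continuous.continuousAt.preimage_mem_nhds
      (Filter.inter_mem (extChartAt_source_mem_nhds' (I := 𝓘(ℝ, E)) hc)
        (extChartAt_source_mem_nhds' (I := 𝓘(ℝ, E)) hcc))
    filter_upwards [eventually_chart_symm_mem hq hn] with z ⟨hz, hz'⟩
    exact ⟨_, (extChartAt 𝓘(ℝ, F) p).map_target hz, (extChartAt 𝓘(ℝ, F) p).right_inv hz, hz'⟩
  have hτ := isCoordChangeAt_chart g hc hcc
  rw [← hx] at hτ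
  rw [h1, ← fderiv_coordChange hc hcc, chartDiff_fromCoord, ← hx]
  symm
  refine IsCoordChangeAt.covAlong (isMetricOn_chartMetric g c) (isMetricOn_chartMetric g (ι q)) hτ
    ?_ ?_ (differentiableAt_of_smooth (contDiffAt_mapInCharts hι hq hcc)) hW ?_ ?_ _
  · rw [hx]; exact (extChartAt 𝓘(ℝ, E) (ι q)).map_source hcc
  · rw [hx, inChart_apply hcc]; exact (extChartAt 𝓘(ℝ, E) c).map_source hc
  · filter_upwards [hev] with z hz
    obtain ⟨q', hq', rfl, h1, h2⟩ := hz
    rw [mapInCharts_apply hq', mapInCharts_apply hq', inChart_apply h2]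
  · filter_upwards [hev] with z hz
    obtain ⟨q', hq', rfl, h1, h2⟩ := hz
    rw [mapInCharts_apply hq', fieldInCharts_apply hq', fieldInCharts_apply hq',
      fderiv_coordChange h1 h2]

/-- The part of the chart around `p` that `ι` sends to the chart around `c`. -/
def chartDomain (F : Type*) [NormedAddCommGroup F] [NormedSpace ℝ F] [ChartedSpace F L]
    (E : Type*) [NormedAddCommGroup E] [NormedSpace ℝ E] [ChartedSpace E M]
    (ι : L → M) (p : L) (c : M) : Set F :=
  (extChartAt 𝓘(ℝ, F) p).target ∩
    (extChartAt 𝓘(ℝ, F) p).symm ⁻¹' (ι ⁻¹' (extChartAt 𝓘(ℝ, E) c).source)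

theorem exists_of_mem_chartDomain {x : F} (hx : x ∈ chartDomain F E ι p c) :
    ∃ q ∈ (extChartAt 𝓘(ℝ, F) p).source, extChartAt 𝓘(ℝ, F) p q = x ∧
      ι q ∈ (extChartAt 𝓘(ℝ, E) c).source :=
  ⟨_, (extChartAt 𝓘(ℝ, F) p).map_target hx.1, (extChartAt 𝓘(ℝ, F) p).right_inv hx.1, hx.2⟩

theorem mem_chartDomain (hq : q ∈ (extChartAt 𝓘(ℝ, F) p).source)
    (hc : ι q ∈ (extChartAt 𝓘(ℝ, E) c).source) :
    extChartAt 𝓘(ℝ, F) p q ∈ chartDomain F E ι p c := by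
  refine ⟨(extChartAt 𝓘(ℝ, F) p).map_source hq, ?_⟩
  change ι ((extChartAt 𝓘(ℝ, F) p).symm (extChartAt 𝓘(ℝ, F) p q)) ∈
    (extChartAt 𝓘(ℝ, E) c).source
  rwa [(extChartAt 𝓘(ℝ, F) p).left_inv hq]

theorem isOpen_chartDomain (hι : Continuous ι) : IsOpen (chartDomain F E ι p c) :=
  (continuousOn_extChartAt_symm p).isOpen_inter_preimage (isOpen_extChartAt_target p)
    ((isOpen_extChartAt_source c).preimage hι)

variable {N : ∀ p : L, TangentSpace 𝓘(ℝ, E) (ι p)}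

/-- An immersed hypersurface with unit normal field, read in charts. -/
theorem isHypersurfaceOn_charts (hdim : Module.finrank ℝ E = Module.finrank ℝ F + 1)
    (hι : ContMDiff 𝓘(ℝ, F) 𝓘(ℝ, E) ∞ ι)
    (hι' : ∀ p : L, Function.Injective (mfderiv 𝓘(ℝ, F) 𝓘(ℝ, E) ι p))
    (hN : IsUnitNormalField F g ι N) (p : L) (c : M) :
    IsHypersurfaceOn (chartMetric g c) (extChartAt 𝓘(ℝ, E) c).target (mapInCharts ι p c)
      (fieldInCharts ι N p c) (chartDomain F E ι p c) where
  metric := isMetricOn_chartMetric g c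
  finrank_eq := hdim
  isOpen := isOpen_chartDomain hι.continuous
  mem x hx := by
    obtain ⟨q, hq, rfl, hc⟩ := exists_of_mem_chartDomain hx
    rw [mapInCharts_apply hq]
    exact (extChartAt 𝓘(ℝ, E) c).map_source hc
  contDiffAt_map x hx := by
    obtain ⟨q, hq, rfl, hc⟩ := exists_of_mem_chartDomain hx
    exact contDiffAt_mapInCharts hι hq hc
  injective x hx := by
    obtain ⟨q, hq, rfl, hc⟩ := exists_of_mem_chartDomain hx
    intro v w hvw
    obtain ⟨v, rfl⟩ := (isInvertible_chartDiff hq).surjective v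
    obtain ⟨w, rfl⟩ := (isInvertible_chartDiff hq).surjective w
    rw [fderiv_mapInCharts hι hq hc, fderiv_mapInCharts hι hq hc] at hvw
    rw [hι' q ((isInvertible_chartDiff hc).injective hvw)]
  contDiffAt_normal x hx := by
    obtain ⟨q, hq, rfl, hc⟩ := exists_of_mem_chartDomain hx
    exact contDiffAt_fieldInCharts hN.contMDiff hq hc
  normal x hx v := by
    obtain ⟨q, hq, rfl, hc⟩ := exists_of_mem_chartDomain hx
    obtain ⟨v, rfl⟩ := (isInvertible_chartDiff hq).surjective v
    rw [fderiv_mapInCharts hι hq hc, mapInCharts_apply hq, fieldInCharts_apply hq,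
      chartMetric_chartDiff g hc, hN.normal]
  unit x hx := by
    obtain ⟨q, hq, rfl, hc⟩ := exists_of_mem_chartDomain hx
    rw [mapInCharts_apply hq, fieldInCharts_apply hq, chartMetric_chartDiff g hc, hN.unit]

end HypersurfaceCharts

/-! ### Transfer of the geometry of the hypersurface to charts -/

section Transfer

variable {F : Type*} [NormedAddCommGroup F] [NormedSpace ℝ F] [FiniteDimensional ℝ F]
  {L : Type*} [TopologicalSpace L] [ChartedSpace F L] [IsManifold 𝓘(ℝ, F) ∞ L] {p q : L}

/-- The differential of a chart, as a linear equivalence. -/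
noncomputable def chartEquiv (hq : q ∈ (extChartAt 𝓘(ℝ, F) p).source) :
    TangentSpace 𝓘(ℝ, F) q ≃ₗ[ℝ] F :=
  LinearEquiv.ofBijective (chartDiff (E := F) p q).toLinearMap (isInvertible_chartDiff hq).bijective

theorem chartEquiv_conj (hq : q ∈ (extChartAt 𝓘(ℝ, F) p).source)
    {B : TangentSpace 𝓘(ℝ, F) q →ₗ[ℝ] TangentSpace 𝓘(ℝ, F) q} {B' : F →ₗ[ℝ] F}
    (h : ∀ v, chartDiff (E := F) p q (B v) = B' (chartDiff p q v)) :
    (chartEquiv hq).conj B = B' := by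
  ext w
  obtain ⟨v, rfl⟩ := (chartEquiv hq).surjective w
  rw [LinearEquiv.conj_apply_apply, LinearEquiv.symm_apply_apply]
  exact h v

theorem tangentTrace_eq (hq : q ∈ (extChartAt 𝓘(ℝ, F) p).source)
    {B : TangentSpace 𝓘(ℝ, F) q →L[ℝ] TangentSpace 𝓘(ℝ, F) q} {B' : F →ₗ[ℝ] F}
    (h : ∀ v, chartDiff (E := F) p q (B v) = B' (chartDiff p q v)) :
    tangentTrace B = LinearMap.trace ℝ F B' := by
  rw [tangentTrace, ← chartEquiv_conj hq (B := B.toLinearMap) h, LinearMap.trace_conj']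

variable {E : Type*} [NormedAddCommGroup E] [NormedSpace ℝ E] [FiniteDimensional ℝ E]
  {M : Type*} [TopologicalSpace M] [ChartedSpace E M] [IsManifold 𝓘(ℝ, E) ∞ M]
  {g : ContMDiffRiemannianMetric 𝓘(ℝ, E) ∞ E (fun x : M => TangentSpace 𝓘(ℝ, E) x)}
  {ι : L → M} {N : ∀ p : L, TangentSpace 𝓘(ℝ, E) (ι p)} {c : M}

theorem inducedMetric_apply (v w : TangentSpace 𝓘(ℝ, F) q) :
    inducedMetric F g ι q v w =
      g.inner (ι q) (mfderiv 𝓘(ℝ, F) 𝓘(ℝ, E) ι q v) (mfderiv 𝓘(ℝ, F) 𝓘(ℝ, E) ι q w) :=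
  rfl

theorem isInvertible_inducedMetric
    (hι' : ∀ p : L, Function.Injective (mfderiv 𝓘(ℝ, F) 𝓘(ℝ, E) ι p)) (q : L) :
    (inducedMetric F g ι q).IsInvertible := by
  refine isInvertible_of_pos (V := F) fun v hv => g.pos _ _ fun h => hv (hι' q ?_)
  exact h.trans (map_zero (mfderiv 𝓘(ℝ, F) 𝓘(ℝ, E) ι q)).symm

theorem inducedMetric_tangentialPart
    (hι' : ∀ p : L, Function.Injective (mfderiv 𝓘(ℝ, F) 𝓘(ℝ, E) ι p))
    (w : TangentSpace 𝓘(ℝ, E) (ι q)) (v : TangentSpace 𝓘(ℝ, F) q) :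
    inducedMetric F g ι q (tangentialPart F g ι q w) v =
      g.inner (ι q) w (mfderiv 𝓘(ℝ, F) 𝓘(ℝ, E) ι q v) := by
  rw [tangentialPart, ContinuousLinearMap.comp_apply,
    (isInvertible_inducedMetric hι' q).self_apply_inverse]
  rfl

theorem inducedMetric_surfaceGradient
    (hι' : ∀ p : L, Function.Injective (mfderiv 𝓘(ℝ, F) 𝓘(ℝ, E) ι p)) (f : L → ℝ)
    (v : TangentSpace 𝓘(ℝ, F) q) :
    inducedMetric F g ι q (surfaceGradient F g ι f q) v = mfderiv 𝓘(ℝ, F) 𝓘(ℝ, ℝ) f q v := by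
  exact congrArg (fun l : TangentSpace 𝓘(ℝ, F) q →L[ℝ] ℝ => l v)
    ((isInvertible_inducedMetric hι' q).self_apply_inverse (mfderiv 𝓘(ℝ, F) 𝓘(ℝ, ℝ) f q))

theorem pullMetric_chartDiff (hι : ContMDiff 𝓘(ℝ, F) 𝓘(ℝ, E) ∞ ι)
    (hq : q ∈ (extChartAt 𝓘(ℝ, F) p).source) (hc : ι q ∈ (extChartAt 𝓘(ℝ, E) c).source)
    (v w : TangentSpace 𝓘(ℝ, F) q) :
    pullMetric (chartMetric g c) (mapInCharts ι p c) (extChartAt 𝓘(ℝ, F) p q)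
      (chartDiff p q v) (chartDiff p q w) = inducedMetric F g ι q v w := by
  rw [pullMetric_apply, fderiv_mapInCharts hι hq hc, fderiv_mapInCharts hι hq hc,
    mapInCharts_apply hq, chartMetric_chartDiff g hc, inducedMetric_apply]

section

variable (hdim : Module.finrank ℝ E = Module.finrank ℝ F + 1)
  (hι : ContMDiff 𝓘(ℝ, F) 𝓘(ℝ, E) ∞ ι)
  (hι' : ∀ p : L, Function.Injective (mfderiv 𝓘(ℝ, F) 𝓘(ℝ, E) ι p))
  (hN : IsUnitNormalField F g ι N)
  (hq : q ∈ (extChartAt 𝓘(ℝ, F) p).source) (hc : ι q ∈ (extChartAt 𝓘(ℝ, E) c).source)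
include hdim hι hι' hN hq hc

theorem chartDiff_tangentialPart (w : TangentSpace 𝓘(ℝ, E) (ι q)) :
    chartDiff p q (tangentialPart F g ι q w) =
      tanPart (chartMetric g c) (mapInCharts ι p c) (extChartAt 𝓘(ℝ, F) p q)
        (chartDiff c (ι q) w) := by
  have H := isHypersurfaceOn_charts hdim hι hι' hN p c
  have hx := mem_chartDomain hq hc
  refine H.ext_left hx fun v => ?_
  obtain ⟨v, rfl⟩ := (isInvertible_chartDiff hq).surjective v
  rw [pullMetric_chartDiff hι hq hc, inducedMetric_tangentialPart hι', H.pullMetric_tanPart hx,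
    fderiv_mapInCharts hι hq hc, mapInCharts_apply hq, chartMetric_chartDiff g hc]

theorem chartDiff_surfaceGradient {f : L → ℝ}
    (hf : DifferentiableAt ℝ (inChart p f) (extChartAt 𝓘(ℝ, F) p q)) :
    chartDiff p q (surfaceGradient F g ι f q) =
      coordGrad (chartMetric g c) (mapInCharts ι p c) (inChart p f) (extChartAt 𝓘(ℝ, F) p q) := by
  have H := isHypersurfaceOn_charts hdim hι hι' hN p c
  have hx := mem_chartDomain hq hc
  refine H.ext_left hx fun v => ?_
  obtain ⟨v, rfl⟩ := (isInvertible_chartDiff hq).surjective v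
  rw [pullMetric_chartDiff hι hq hc, inducedMetric_surfaceGradient hι',
    H.pullMetric_coordGrad hx, mfderiv_eq_fderiv_inChart hq hf]

theorem chartDiff_shapeOperator (v : TangentSpace 𝓘(ℝ, F) q) :
    chartDiff p q (shapeOperator F g ι N q v) =
      coordShape (chartMetric g c) (mapInCharts ι p c) (fieldInCharts ι N p c)
        (extChartAt 𝓘(ℝ, F) p q) (chartDiff p q v) := by
  have h1 : shapeOperator F g ι N q v = -tangentialPart F g ι q (covDerivAlong F g ι N q v) := rfl
  rw [h1, map_neg, chartDiff_tangentialPart hdim hι hι' hN hq hc,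
    chartDiff_covDerivAlong hι hq hc (differentiableAt_of_smooth
      (contDiffAt_fieldInCharts hN.contMDiff hq (mem_extChartAt_source (ι q))))]
  rfl

theorem shapeOperator_conj : (chartEquiv hq).conj (shapeOperator F g ι N q).toLinearMap =
    (coordShape (chartMetric g c) (mapInCharts ι p c) (fieldInCharts ι N p c)
        (extChartAt 𝓘(ℝ, F) p q) : F →ₗ[ℝ] F) :=
  chartEquiv_conj hq (chartDiff_shapeOperator hdim hι hι' hN hq hc)

/-- The mean curvatures are smooth functions of the shape operator, because the latter is
diagonalizable. -/
theorem meanCurvature_eq (r : ℕ) : meanCurvature F g ι N r q =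
    endSymm (coordShape (chartMetric g c) (mapInCharts ι p c) (fieldInCharts ι N p c)
        (extChartAt 𝓘(ℝ, F) p q) : F →ₗ[ℝ] F) r := by
  have H := isHypersurfaceOn_charts hdim hι hι' hN p c
  have hx := mem_chartDomain hq hc
  rw [← esymm_roots_charpoly, meanCurvature, principalCurvatures,
    ← shapeOperator_conj hdim hι hι' hN hq hc, LinearEquiv.charpoly_conj]
  exact splits_charpoly_of_symm
    ((ContinuousLinearMap.coeLM ℝ).comp (pullMetric (chartMetric g c) (mapInCharts ι p c)
      (extChartAt 𝓘(ℝ, F) p q)).toLinearMap)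
    (H.pullMetric_symm hx) (H.pullMetric_pos hx) (H.coordShape_symm hx)

theorem chartDiff_newton (r : ℕ) (v : TangentSpace 𝓘(ℝ, F) q) :
    chartDiff p q (newton F g ι N r q v) =
      endNewton (coordShape (chartMetric g c) (mapInCharts ι p c) (fieldInCharts ι N p c)
        (extChartAt 𝓘(ℝ, F) p q) : F →ₗ[ℝ] F) r (chartDiff p q v) := by
  induction r generalizing v with
  | zero => rfl
  | succ r ih =>
    have h1 : newton F g ι N (r + 1) q v = meanCurvature F g ι N (r + 1) q • v -
      shapeOperator F g ι N q (newton F g ι N r q v) := rfl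
    rw [h1, map_sub, map_smul, chartDiff_shapeOperator hdim hι hι' hN hq hc, ih,
      meanCurvature_eq hdim hι hι' hN hq hc]
    rfl

end

section

variable (hdim : Module.finrank ℝ E = Module.finrank ℝ F + 1)
  (hι : ContMDiff 𝓘(ℝ, F) 𝓘(ℝ, E) ∞ ι)
  (hι' : ∀ p : L, Function.Injective (mfderiv 𝓘(ℝ, F) 𝓘(ℝ, E) ι p))
  (hN : IsUnitNormalField F g ι N)
include hdim hι hι' hN

theorem chartDiff_normalCurvature (p : L) (v : TangentSpace 𝓘(ℝ, F) p) :
    chartDiff p p (normalCurvature F g ι N p v) =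
      coordNormalCurvature (chartMetric g (ι p)) (mapInCharts ι p (ι p))
        (fieldInCharts ι N p (ι p)) (extChartAt 𝓘(ℝ, F) p p) (chartDiff p p v) := by
  have hp := mem_extChartAt_source (I := 𝓘(ℝ, F)) p
  have hc := mem_extChartAt_source (I := 𝓘(ℝ, E)) (ι p)
  have h1 : normalCurvature F g ι N p v = tangentialPart F g ι p (fromCoord (ι p)
      (coordCurvature (chartMetric g (ι p)) (extChartAt 𝓘(ℝ, E) (ι p) (ι p))
        (chartDiff (ι p) (ι p) (N p)) (chartDiff (ι p) (ι p) (N p))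
        (chartDiff (ι p) (ι p) (mfderiv 𝓘(ℝ, F) 𝓘(ℝ, E) ι p v)))) := rfl
  have h2 : ∀ w, coordNormalCurvature (chartMetric g (ι p)) (mapInCharts ι p (ι p))
        (fieldInCharts ι N p (ι p)) (extChartAt 𝓘(ℝ, F) p p) w =
      tanPart (chartMetric g (ι p)) (mapInCharts ι p (ι p)) (extChartAt 𝓘(ℝ, F) p p)
        (coordCurvature (chartMetric g (ι p))
          (mapInCharts (F := F) ι p (ι p) (extChartAt 𝓘(ℝ, F) p p))
          (fieldInCharts (F := F) ι N p (ι p) (extChartAt 𝓘(ℝ, F) p p))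
          (fieldInCharts (F := F) ι N p (ι p) (extChartAt 𝓘(ℝ, F) p p))
          (fderiv ℝ (mapInCharts (F := F) ι p (ι p)) (extChartAt 𝓘(ℝ, F) p p) w)) := fun _ => rfl
  rw [h1, chartDiff_tangentialPart hdim hι hι' hN hp hc, chartDiff_fromCoord, h2,
    fderiv_mapInCharts hι hp hc, mapInCharts_apply hp, fieldInCharts_apply hp]

theorem chartDiff_hessian (p : L) {f : L → ℝ} {f' : F → ℝ}
    (hf : ∀ x ∈ chartDomain F E ι p (ι p), inChart p f x = f' x)
    (hf' : ∀ x ∈ chartDomain F E ι p (ι p), ContDiffAt ℝ ∞ f' x) (v : TangentSpace 𝓘(ℝ, F) p) :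
    chartDiff p p (hessian F g ι f p v) =
      coordHess (chartMetric g (ι p)) (mapInCharts ι p (ι p)) f' (extChartAt 𝓘(ℝ, F) p p)
        (chartDiff p p v) := by
  have H := isHypersurfaceOn_charts hdim hι hι' hN p (ι p)
  have hp := mem_extChartAt_source (I := 𝓘(ℝ, F)) p
  have hc := mem_extChartAt_source (I := 𝓘(ℝ, E)) (ι p)
  have hx := mem_chartDomain hp hc
  have hev : fieldInCharts (F := F) ι
      (fun q => mfderiv 𝓘(ℝ, F) 𝓘(ℝ, E) ι q (surfaceGradient F g ι f q)) p (ι p)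
      =ᶠ[nhds (extChartAt 𝓘(ℝ, F) p p)] fun x => fderiv ℝ (mapInCharts ι p (ι p)) x
        (coordGrad (chartMetric g (ι p)) (mapInCharts ι p (ι p)) f' x) := by
    filter_upwards [H.isOpen.mem_nhds hx] with x hx
    have h1 : inChart p f =ᶠ[nhds x] f' := by
      filter_upwards [H.isOpen.mem_nhds hx] with z hz using hf z hz
    have h2 := (differentiableAt_of_smooth (hf' x hx)).congr_of_eventuallyEq h1
    obtain ⟨q, hq, rfl, hcq⟩ := exists_of_mem_chartDomain hx
    rw [fieldInCharts_apply hq, ← fderiv_mapInCharts hι hq hcq,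
      chartDiff_surfaceGradient hdim hι hι' hN hq hcq h2, coordGrad, h1.fderiv_eq]
    rfl
  have hd := differentiableAt_of_smooth ((H.contDiffAt_fderiv_map hx).clm_apply
    (H.contDiffAt_coordGrad hx (hf' _ hx)))
  have h1 : hessian F g ι f p v = tangentialPart F g ι p (covDerivAlong F g ι
    (fun q => mfderiv 𝓘(ℝ, F) 𝓘(ℝ, E) ι q (surfaceGradient F g ι f q)) p v) := rfl
  rw [h1, chartDiff_tangentialPart hdim hι hι' hN hp hc,
    chartDiff_covDerivAlong hι hp hc (hd.congr_of_eventuallyEq hev), covAlong_congr hev]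
  rfl

end

end Transfer

end HypersurfaceGeometry

/-! ### The formulas for `J_r` and `L_r` -/

theorem theoremt {n : ℕ}
    {E : Type*} [NormedAddCommGroup E] [NormedSpace ℝ E] [FiniteDimensional ℝ E]
    {F : Type*} [NormedAddCommGroup F] [NormedSpace ℝ F] [FiniteDimensional ℝ F]
    (hE : Module.finrank ℝ E = n + 1) (hF : Module.finrank ℝ F = n)
    {M : Type*} [TopologicalSpace M] [ChartedSpace E M] [IsManifold 𝓘(ℝ, E) ∞ M]
    {L : Type*} [TopologicalSpace L] [ChartedSpace F L] [IsManifold 𝓘(ℝ, F) ∞ L]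
    (g : ContMDiffRiemannianMetric 𝓘(ℝ, E) ∞ E (fun x : M => TangentSpace 𝓘(ℝ, E) x))
    (ι : L → M) (hι : ContMDiff 𝓘(ℝ, F) 𝓘(ℝ, E) ∞ ι)
    (hι' : ∀ p : L, Function.Injective (mfderiv 𝓘(ℝ, F) 𝓘(ℝ, E) ι p))
    (N : ∀ p : L, TangentSpace 𝓘(ℝ, E) (ι p)) (hN : IsUnitNormalField F g ι N)
    (U : ∀ x : M, TangentSpace 𝓘(ℝ, E) x) (k : M → ℝ) (hU : IsConformalField g U k)
    (f : L → ℝ) (hf : ∀ p : L, f p = g.inner (ι p) (U (ι p)) (N p))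
    (r : ℕ) (p : L) :
    operatorJ F g ι N r f p =
        -directionalDeriv (meanCurvature F g ι N (r + 1)) p (tangentialPart F g ι p (U (ι p)))
          - ((r : ℝ) + 1) * k (ι p) * meanCurvature F g ι N (r + 1) p
          - directionalDeriv k (ι p) (N p) * ((n : ℝ) - (r : ℝ))
            * meanCurvature F g ι N r p
      ∧ operatorL F g ι N r f p =
        -(g.inner (ι p) (U (ι p))
            (mfderiv 𝓘(ℝ, F) 𝓘(ℝ, E) ι p (surfaceGradient F g ι (meanCurvature F g ι N (r + 1)) p)))
          - f p * tangentTrace ((shapeOperator F g ι N p).comp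
              ((shapeOperator F g ι N p).comp (newton F g ι N r p)))
          - f p * tangentTrace ((normalCurvature F g ι N p).comp (newton F g ι N r p))
          - k (ι p) * tangentTrace ((shapeOperator F g ι N p).comp (newton F g ι N r p))
          - directionalDeriv k (ι p) (N p) * tangentTrace (newton F g ι N r p) := by

  have hdim : Module.finrank ℝ E = Module.finrank ℝ F + 1 := by rw [hE, hF]
  have hp := mem_extChartAt_source (I := 𝓘(ℝ, F)) p
  have hc := mem_extChartAt_source (I := 𝓘(ℝ, E)) (ι p)
  have H := isHypersurfaceOn_charts hdim hι hι' hN p (ι p)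
  have hu := hU.isConformalOn (ι p)
  have hx := mem_chartDomain hp hc
  set φ : F → E := mapInCharts ι p (ι p) with hφ
  set ν : F → E := fieldInCharts ι N p (ι p) with hν
  set u : E → E := chartField U (ι p) with hudef
  set x : F := extChartAt 𝓘(ℝ, F) p p with hxdef
  set a : Module.End ℝ F := (coordShape (chartMetric g (ι p)) φ ν x : F →ₗ[ℝ] F) with ha
  set T : Module.End ℝ F := endNewton a r with hT
  have hφx : φ x = extChartAt 𝓘(ℝ, E) (ι p) (ι p) := mapInCharts_apply hp
  have hνx : ν x = chartDiff (ι p) (ι p) (N p) := fieldInCharts_apply hp N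
  have hux : u (φ x) = chartDiff (ι p) (ι p) (U (ι p)) := by rw [hφx, hudef, chartField_apply hc]
  -- the function `f` is the support function in the chart
  have hf' : ∀ y ∈ chartDomain F E ι p (ι p),
      inChart p f y = supportFunction (chartMetric g (ι p)) φ ν u y := by
    intro y hy
    obtain ⟨q, hq, rfl, hcq⟩ := exists_of_mem_chartDomain hy
    rw [inChart_apply hq, hf, supportFunction, hφ, mapInCharts_apply hq, hν, fieldInCharts_apply hq,
      hudef, chartField_apply hcq, chartMetric_chartDiff g hcq]
  have hfx : f p = supportFunction (chartMetric g (ι p)) φ ν u x := by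
    rw [← hf' x hx, inChart_apply hp]
  have hA := chartDiff_shapeOperator hdim hι hι' hN hp hc
  have hTn := chartDiff_newton hdim hι hι' hN hp hc r
  have hR := chartDiff_normalCurvature hdim hι hι' hN p
  have hH := chartDiff_hessian hdim hι hι' hN p hf' fun y hy => contDiffAt_supportFunction H hu hy
  -- the traces in the formula, computed in the chart
  have tL : operatorL F g ι N r f p = LinearMap.trace ℝ F
      (T * (coordHess (chartMetric g (ι p)) φ (supportFunction (chartMetric g (ι p)) φ ν u) x :
        F →ₗ[ℝ] F)) :=
    tangentTrace_eq hp fun v => (hTn _).trans (congrArg T (hH v))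
  have tT : tangentTrace (newton F g ι N r p) = LinearMap.trace ℝ F T := tangentTrace_eq hp hTn
  have tA : tangentTrace ((shapeOperator F g ι N p).comp (newton F g ι N r p)) =
      LinearMap.trace ℝ F (a * T) :=
    tangentTrace_eq hp fun v => (hA _).trans (congrArg a (hTn v))
  have tAA : tangentTrace ((shapeOperator F g ι N p).comp
      ((shapeOperator F g ι N p).comp (newton F g ι N r p))) =
      LinearMap.trace ℝ F (a * (a * T)) :=
    tangentTrace_eq hp fun v => (hA _).trans (congrArg a ((hA _).trans (congrArg a (hTn v))))
  have tR : tangentTrace ((normalCurvature F g ι N p).comp (newton F g ι N r p)) =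
      LinearMap.trace ℝ F
        ((coordNormalCurvature (chartMetric g (ι p)) φ ν x : F →ₗ[ℝ] F) * T) :=
    tangentTrace_eq hp fun v => (hR _).trans
      (congrArg (coordNormalCurvature (chartMetric g (ι p)) φ ν x) (hTn v))
  -- the derivatives in the formula, computed in the chart
  have hS : inChart p (meanCurvature F g ι N (r + 1)) =ᶠ[nhds x] fun y =>
      endSymm (coordShape (chartMetric g (ι p)) φ ν y : F →ₗ[ℝ] F) (r + 1) := by
    filter_upwards [H.isOpen.mem_nhds hx] with y hy
    obtain ⟨q, hq, rfl, hcq⟩ := exists_of_mem_chartDomain hy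
    rw [inChart_apply hq, meanCurvature_eq hdim hι hι' hN hq hcq]
  have hSd := (hasFDerivAt_endSymm (differentiableAt_of_smooth
    (H.contDiffAt_coordShape hx)) r).1.congr_of_eventuallyEq hS
  have dS : directionalDeriv (meanCurvature F g ι N (r + 1)) p
      (tangentialPart F g ι p (U (ι p))) =
      fderiv ℝ (fun y => endSymm (coordShape (chartMetric g (ι p)) φ ν y : F →ₗ[ℝ] F) (r + 1)) x
        (tanPart (chartMetric g (ι p)) φ x (u (φ x))) := by
    rw [directionalDeriv, mfderiv_eq_fderiv_inChart hp hSd, hS.fderiv_eq,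
      chartDiff_tangentialPart hdim hι hι' hN hp hc, hux]
  have dk : directionalDeriv k (ι p) (N p) = fderiv ℝ (inChart (ι p) k) (φ x) (ν x) := by
    rw [directionalDeriv, mfderiv_eq_fderiv_inChart hc (differentiableAt_of_smooth
      (contDiffAt_inChart hc hU.contMDiff_factor.contMDiffAt)), hφx, hνx]
  have hkx : inChart (ι p) k (φ x) = k (ι p) := by rw [hφx, inChart_apply hc]
  have gS : g.inner (ι p) (U (ι p)) (mfderiv 𝓘(ℝ, F) 𝓘(ℝ, E) ι p
      (surfaceGradient F g ι (meanCurvature F g ι N (r + 1)) p)) =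
      directionalDeriv (meanCurvature F g ι N (r + 1)) p (tangentialPart F g ι p (U (ι p))) := by
    rw [← inducedMetric_tangentialPart hι', inducedMetric_apply, g.symm, ← inducedMetric_apply,
      inducedMetric_surfaceGradient hι']
    rfl
  have key := trace_newton_coordHess_supportFunction H hu hx r ha hT
  rw [← tL, ← tT, ← tA, ← tAA, ← tR, ← hfx, ← dS, ← dk, hkx] at key
  have mA : tangentTrace ((shapeOperator F g ι N p).comp (newton F g ι N r p)) =
      (r + 1) * meanCurvature F g ι N (r + 1) p := by
    rw [tA, meanCurvature_eq hdim hι hι' hN hp hc]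
    exact trace_comp_endNewton a r
  have mT : tangentTrace (newton F g ι N r p) = (n - r) * meanCurvature F g ι N r p := by
    rw [tT, meanCurvature_eq hdim hι hι' hN hp hc, ← hF]
    exact trace_endNewton a r
  refine ⟨?_, by rw [gS]; exact key⟩
  rw [operatorJ, key, mA, mT]
  ring
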